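/- **Model (Harsh).** A read-only cloud stores a bit array $X\in\{0,1\}^n$; there are $k$ machines, $2\le k\le n$, joined by a complete network. Computation proceeds in synchronous rounds. In a round each machine first draws local random values and sends queries to the cloud (a query $j\in\{1,\dots,n\}$ is answered by $X[j]$), and then sends at most one $O(\log n)$-bit message (an index in $\{1,\dots,n\}$) to each other machine. Let $0\le\beta<1$ and $\gamma=1-\beta$; the machines know $n,k,\beta$. An adaptive adversary knows $X$. At the start of each round, knowing all random values, queries and messages of the earlier rounds, it may corrupt further machines, as long as at most $\beta k$ machines are corrupted in total; corrupted machines send arbitrary messages of its choice (which may even depend on the random values of the current round). A machine is honest if it is never corrupted. $\mathcal Q$ is the maximum number of queries made by an honest machine, $\mathcal T$ the number of rounds until all honest machines have terminated, $\mathcal M$ the total number of messages sent by honest machines. **Problem (Disjunction).** Every honest machine has to terminate with output $1$ if $X[j]=1$ for some $j$, and with output $0$ otherwise. Let $\delta$ be the fraction of ones in $X$ and $\bar\delta=\max(1/n,\delta)$. **Algorithm Randomized_Disjunction** (code for a machine $M$). $M$ keeps the set $\mathcal K$ of its verified indices, i.e. those indices $j$ that it has queried with answer $1$; initially $\mathcal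 K=\emptyset$. For $r=1,\dots,\lceil\log_2 n\rceil$: 1. Draw $\lceil 2^r\ln n/(\gamma k)\rceil$ independent uniform indices from $\{1,\dots,n\}$, query them, and add those with answer $1$ to $\mathcal K$. 2. (Spread.) Repeat $\lceil\log_2 k\rceil$ times: if $\mathcal K\neq\emptyset$, send an arbitrary element of $\mathcal K$ to all other machines; let $S$ be the array of the indices received, with one entry for each machine from which an index was received; if $S$ is not empty, draw $\lceil 8\ln n/\gamma\rceil$ independent uniform entries of $S$, query them, and add those with answer $1$ to $\mathcal K$. (The messages of the first repetition are sent in the round of the queries of step 1; the queries of each repetition, and the messages of the next one, take place in the round after its messages.) 3. If $\mathcal K$ was nonempty at the beginning of step 2, return $1$. After the loop return $1$ if $\mathcal K\ne\emptyset$, and $0$ otherwise. **Theorem.** There is an absolute constant $C>0$ such that for all $2\le k\le n$, all $0\le\beta<1$, all rules for the arbitrary choices in step 2, all inputs $X$ and all adversaries as above, with probability at least $1-C/n$ Algorithm Randomized_Disjunction solves Disjunction, with $$\mathcal Q\le C\Big(\frac{\log_2 n}{\gamma k\bar\delta}+\frac{\log_2 k\,\log_2 n\,\log_2(2/\bar\delta)}{\gamma}\Big),\qquad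 \mathcal T\le \big\lceil C\log_2 k\,\log_2(2/\bar\delta)\big\rceil,\qquad \mathcal M\le C\,k^2\log_2 k\,\log_2(2/\bar\delta).$$ -/

import Mathlib

/-! ### Elementary random sampling -/

namespace CCA

noncomputable section

/-- The joint law of `k` independent random variables, the `i`-th of which has law `p i`. -/
def indep {α : Type} : (k : ℕ) → (Fin k → PMF α) → PMF (Fin k → α)
  | 0, _ => PMF.pure Fin.elim0
  | k + 1, p =>
      (p 0).bind fun a => (indep k fun i => p i.succ).bind fun f => PMF.pure (Fin.cons a f)

/-- The list of `m` independent draws from `p`. -/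
def draws {α : Type} (p : PMF α) : ℕ → PMF (List α)
  | 0 => PMF.pure []
  | m + 1 => p.bind fun a => (draws p m).bind fun l => PMF.pure (a :: l)

open Classical in
/-- `m` independent uniform draws (with replacement) from the entries of the array `S`,
repeated entries being counted with multiplicity.  Nothing is drawn from an empty array. -/
def sample {α : Type} (S : Multiset α) (m : ℕ) : PMF (List α) :=
  if h : S = 0 then PMF.pure [] else draws (PMF.ofMultiset S h) m

/-! ### The congested clique with cloud assistance -/

/-- A randomized synchronous protocol for `k` machines and a cloud that stores `n` bits.
In every round a machine

* draws a local random value with law `coin`;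
* sends the cloud the queries `query` and updates its state by `learn`, which gets the queried
  indices together with the answers of the cloud, and nothing else about the input;
* sends at most one message to each other machine (`send`); a message is an index in
  `{1, …, n}`, hence has `O(log n)` bits;
* updates its state by `receive`, from what came in from the other machines.

A machine has terminated with output `b` as soon as `output` is `some b`. -/
structure Protocol (k n : ℕ) where
  State : Type
  Coin : Type
  init : Fin k → State
  coin : State → PMF Coin
  query : State → Coin → List (Fin n)
  learn : State → Coin → List (Fin n × Bool) → State
  send : State → Fin k → Option (Fin n)
  receive : State → (Fin k → Option (Fin n)) → State
  output : State → Option Bool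

variable {k n : ℕ}

/-- The complete record of one round. -/
structure Round (P : Protocol k n) where
  /-- the machines that are corrupted in this round -/
  corrupted : Finset (Fin k)
  /-- the local random values of this round -/
  coin : Fin k → P.Coin
  /-- the queries made in this round by the machines that follow the protocol -/
  query : Fin k → List (Fin n)
  /-- `msg i j` is the message sent by `i` to `j` -/
  msg : Fin k → Fin k → Option (Fin n)
  /-- the states at the end of the round -/
  state : Fin k → P.State

/-- What happened so far, the most recent round first. -/
abbrev History (P : Protocol k n) : Type := List (Round P)

/-- The current states of the machines. -/
def History.state {P : Protocol k n} : History P → Fin k → P.State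
  | [] => P.init
  | R :: _ => R.state

/-- The machines corrupted so far. -/
def History.corrupted {P : Protocol k n} : History P → Finset (Fin k)
  | [] => ∅
  | R :: _ => R.corrupted

/-- The number of queries that machine `i` has made so far. -/
def History.queries {P : Protocol k n} (h : History P) (i : Fin k) : ℕ :=
  (h.map fun R => (R.query i).length).sum

/-- The number of messages sent so far by the machines that have not been corrupted. -/
def History.messages {P : Protocol k n} (h : History P) : ℕ :=
  (h.map fun R => ∑ i ∈ (History.corrupted h)ᶜ,
    (Finset.univ.filter fun j => (R.msg i j).isSome).card).sum

/-- An adaptive adversary.  At the start of a round it names the machines it wants to corrupt,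
knowing the history of all the previous rounds (the corruptions, random values, queries, messages
and states of all machines).  It also chooses the messages that the corrupted machines send in
that round, knowing in addition the random values of the current round.  It may depend on the
input, since it is chosen after the input. -/
structure Adversary (P : Protocol k n) where
  corrupt : History P → Finset (Fin k)
  send : History P → (Fin k → P.Coin) → Fin k → Fin k → Option (Fin n)

/-- The corrupted machines in the round that follows `h`.  A corruption that would take the total
number above the budget `b` does not take place. -/
def Adversary.nextCorrupted {P : Protocol k n} (adv : Adversary P) (b : ℕ) (h : History P) :
    Finset (Fin k) :=
  if (h.corrupted ∪ adv.corrupt h).card ≤ b then h.corrupted ∪ adv.corrupt h else h.corrupted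

/-- Machine `i` follows the protocol in the round after `h`: it is not corrupted and has not yet
terminated. -/
def Active {P : Protocol k n} (adv : Adversary P) (b : ℕ) (h : History P) (i : Fin k) : Prop :=
  i ∉ adv.nextCorrupted b h ∧ P.output (h.state i) = none

open Classical in
/-- The round that follows `h` on input `X` if the local random values are `c`. -/
def nextRound (P : Protocol k n) (X : Fin n → Bool) (adv : Adversary P) (b : ℕ)
    (h : History P) (c : Fin k → P.Coin) : Round P :=
  let query : Fin k → List (Fin n) := fun i =>
    if Active adv b h i then P.query (h.state i) (c i) else []
  let mid : Fin k → P.State := fun i =>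
    P.learn (h.state i) (c i) ((query i).map fun x => (x, X x))
  let msg : Fin k → Fin k → Option (Fin n) := fun i j =>
    if i = j then none
    else if i ∈ adv.nextCorrupted b h then adv.send h c i j
    else if Active adv b h i then P.send (mid i) j
    else none
  { corrupted := adv.nextCorrupted b h
    coin := c
    query := query
    msg := msg
    state := fun i =>
      if Active adv b h i then P.receive (mid i) (fun j => msg j i) else h.state i }

/-- The law of the history after `t` rounds of the protocol `P` on input `X` against an adaptive
adversary that may corrupt at most `b` machines. -/
def run (P : Protocol k n) (X : Fin n → Bool) (adv : Adversary P) (b : ℕ) : ℕ → PMF (History P)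
  | 0 => PMF.pure []
  | t + 1 =>
      (run P X adv b t).bind fun h =>
        (indep k fun i => P.coin (h.state i)).map fun c => nextRound P X adv b h c :: h

/-- All honest machines have terminated with the disjunction of the input bits as output. -/
def SolvesDisjunction {P : Protocol k n} (X : Fin n → Bool) (h : History P) : Prop :=
  ∀ i ∉ h.corrupted, P.output (h.state i) = some (decide (∃ j, X j = true))

/-- `max (1/n) δ`, where `δ` is the fraction of ones in the input. -/
def modifiedDensity (X : Fin n → Bool) : ℝ :=
  max (1 / (n : ℝ)) (((Finset.univ.filter fun j => X j = true).card : ℝ) / n)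

/-! ### The algorithm `Randomized_Disjunction` -/

/-- The local state of a machine. -/
structure RDState (k n : ℕ) where
  /-- the identity of the machine -/
  id : Fin k
  /-- the current iteration of the main loop, counted from `1` -/
  r : ℕ
  /-- the current round of the iteration: round `0` queries the sample of the main loop, and
  round `s ≥ 1` makes the queries of phase `s` of `Spread`; the messages of phase `s + 1` of
  `Spread` are sent in round `s` -/
  s : ℕ
  /-- the verified indices of the machine: those it has queried with answer `1` -/
  K : Finset (Fin n)
  /-- whether `K` was nonempty when `Spread` was called in the current iteration -/
  found : Bool
  /-- the indices received in the preceding round -/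
  inbox : Fin k → Option (Fin n)
  /-- the returned value -/
  out : Option Bool

/-- The array of the indices received, one entry for each machine from which one was received. -/
def RDState.received (σ : RDState k n) : Multiset (Fin n) :=
  (Finset.univ : Finset (Fin k)).val.filterMap σ.inbox

/-- The queries of a round: in round `0` of iteration `r` a sample of `⌈2 ^ r * ln n / (γ k)⌉`
uniform indices, in the later rounds a sample of `⌈8 ln n / γ⌉` entries of the array of received
indices. -/
def RDState.sample (γ : ℝ) (σ : RDState k n) : PMF (List (Fin n)) :=
  if σ.s = 0 then
    CCA.sample (Finset.univ : Finset (Fin n)).val ⌈2 ^ σ.r * (1 / (γ * k)) * Real.log n⌉₊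
  else CCA.sample σ.received ⌈8 * Real.log n / γ⌉₊

/-- The update after the answers of the cloud.  In the last round of an iteration the machine
returns `1` if it had a verified index when `Spread` was called in this iteration; a machine that
learned its first verified index in `Spread` takes it along to the next iteration.  After the last
iteration the machine returns `1` if it has a verified index, and `0` otherwise. -/
def RDState.learn (σ : RDState k n) (ans : List (Fin n × Bool)) : RDState k n :=
  let K := σ.K ∪ ((ans.filter fun a => a.2).map fun a => a.1).toFinset
  let found := if σ.s = 0 then decide K.Nonempty else σ.found
  { σ with
    K := K
    found := found
    out :=
      if σ.s < Nat.clog 2 k then none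
      else if found then some true
      else if σ.r < Nat.clog 2 n then none
      else some (decide K.Nonempty) }

/-- A machine with a verified index sends one to all machines, in each phase of `Spread`. -/
def RDState.send (pick : Fin k → ℕ → ℕ → Finset (Fin n) → Fin n) (σ : RDState k n) :
    Option (Fin n) :=
  if σ.s < Nat.clog 2 k ∧ σ.K.Nonempty then some (pick σ.id σ.r σ.s σ.K) else none

/-- Store the received indices and pass to the next round. -/
def RDState.receive (σ : RDState k n) (inbox : Fin k → Option (Fin n)) : RDState k n :=
  if σ.s < Nat.clog 2 k then { σ with s := σ.s + 1, inbox := inbox }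
  else { σ with r := σ.r + 1, s := 0, inbox := inbox }

/-- Algorithm `Randomized_Disjunction`, with `⌈log₂ n⌉` iterations and `⌈log₂ k⌉` phases of
`Spread` in each of them.  `pick i r s K` is the index in `K` that machine `i` picks for its
messages in round `s` of iteration `r`. -/
def randomizedDisjunction (k n : ℕ) (γ : ℝ) (pick : Fin k → ℕ → ℕ → Finset (Fin n) → Fin n) :
    Protocol k n where
  State := RDState k n
  Coin := List (Fin n)
  init i := { id := i, r := 1, s := 0, K := ∅, found := false, inbox := fun _ => none, out := none }
  coin σ := σ.sample γ
  query _ c := c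
  learn σ _ ans := σ.learn ans
  send σ _ := σ.send pick
  receive σ inbox := σ.receive inbox
  output σ := σ.out

end

end CCA

/-! Let the input have m ≥ 1 ones, and let R ≥ 1 be the first iteration with 2^R m ≥ n; then 2^R is
at most 2 divided by the modified density. Everything rests on the order of events in a round:
corruptions are fixed before the random values are drawn, and messages leave in the same round as
the queries. Hence, given the history, the at least γk machines not corrupted in the round draw
independently, and an index found in it is sent before its finder can be corrupted.

If no uncorrupted machine has a verified index after step 1, none returns in this iteration. In
iteration R the uncorrupted machines jointly draw at least 2^R ln n indices, and all of these miss
with probability at most 1/n (`toOuterMeasure_holders_empty_le`). Once some uncorrupted machine has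
an index after step 1, `Spread` takes over. With g good senders, an array of at most k entries
contains at least g ones, however the corrupted machines fill the rest, so a receiver misses with
probability at most exp(-8 g ln n / (γk)). A Chernoff bound (`toOuterMeasure_indep_card_lt_of_miss`)
gives at least min(2g, γk/2) next senders up to probability n^(-2). After the doubling phases a
union bound informs every uncorrupted machine, and from then on all of them return 1 by the end of
iteration R + 1 with certainty.

`Progress` is the chain from `Searching` through `Spreading` to `Informed`. Conditional one-round
failures add up along the run; only the rounds of the first R iterations carry risk, so the total is
O(1/n) uniformly in the number t of rounds. Separately, `Accounted` holds surely: verified indices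
are ones, and the iteration and round counters of a machine determine the elapsed time while it runs
and bound its queries and messages. Bounding the iteration thus bounds all costs, and an input
without ones needs no probability at all. -/

open scoped ENNReal

namespace CCA

/-! ### Expectations of nonnegative functions -/

/-- The expectation of `f` under `p`. -/
noncomputable def expect {α : Type*} (p : PMF α) (f : α → ℝ≥0∞) : ℝ≥0∞ := ∑' a, p a * f a

section expect

variable {α β : Type*}

theorem toOuterMeasure_eq_expect (p : PMF α) (s : Set α) :
    p.toOuterMeasure s = expect p (s.indicator 1) := by
  classical
  rw [PMF.toOuterMeasure_apply]
  refine tsum_congr fun a => ?_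
  by_cases h : a ∈ s <;> simp [h]

theorem expect_mono {p : PMF α} {f g : α → ℝ≥0∞} (h : ∀ a ∈ p.support, f a ≤ g a) :
    expect p f ≤ expect p g := by
  refine ENNReal.tsum_le_tsum fun a => ?_
  by_cases ha : a ∈ p.support
  · exact mul_le_mul_right (h a ha) _
  · simp [(PMF.apply_eq_zero_iff p a).2 ha]

theorem expect_const (p : PMF α) (c : ℝ≥0∞) : expect p (fun _ => c) = c := by
  rw [expect, ENNReal.tsum_mul_right, p.tsum_coe, one_mul]

theorem expect_const_mul (p : PMF α) (c : ℝ≥0∞) (f : α → ℝ≥0∞) :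
    expect p (fun a => c * f a) = c * expect p f := by
  rw [expect, expect, ← ENNReal.tsum_mul_left]
  exact tsum_congr fun a => by ring

theorem expect_add (p : PMF α) (f g : α → ℝ≥0∞) :
    expect p (fun a => f a + g a) = expect p f + expect p g := by
  simp only [expect, mul_add, ENNReal.tsum_add]

theorem expect_pure (a : α) (f : α → ℝ≥0∞) : expect (PMF.pure a) f = f a := by
  rw [expect, tsum_eq_single a]
  · simp
  · intro b hb
    simp [hb]

theorem expect_bind (p : PMF α) (q : α → PMF β) (f : β → ℝ≥0∞) :
    expect (p.bind q) f = expect p fun a => expect (q a) f := by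
  simp only [expect, PMF.bind_apply, ← ENNReal.tsum_mul_right, ← ENNReal.tsum_mul_left]
  rw [ENNReal.tsum_comm]
  exact tsum_congr fun a => tsum_congr fun b => by ring

theorem toOuterMeasure_add_compl (p : PMF α) (s : Set α) :
    p.toOuterMeasure s + p.toOuterMeasure sᶜ = 1 := by
  classical
  rw [toOuterMeasure_eq_expect, toOuterMeasure_eq_expect, ← expect_add, ← expect_const p 1]
  congr 1
  funext a
  by_cases h : a ∈ s <;> simp [h]

/-- Markov's inequality. -/
theorem toOuterMeasure_le_of_one_le {p : PMF α} {s : Set α} {f : α → ℝ≥0∞}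
    (h : ∀ a ∈ s, 1 ≤ f a) : p.toOuterMeasure s ≤ expect p f := by
  classical
  rw [toOuterMeasure_eq_expect]
  refine expect_mono fun a _ => ?_
  by_cases ha : a ∈ s
  · simpa [ha] using h a ha
  · simp [ha]

/-- One step of a union bound along a Markov chain. -/
theorem toOuterMeasure_bind_compl_le {p : PMF α} {q : α → PMF β} {s : Set α} {t : Set β}
    {ε : ℝ≥0∞} (h : ∀ a ∈ p.support, a ∈ s → (q a).toOuterMeasure tᶜ ≤ ε) :
    (p.bind q).toOuterMeasure tᶜ ≤ p.toOuterMeasure sᶜ + ε := by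
  classical
  rw [toOuterMeasure_eq_expect, expect_bind, toOuterMeasure_eq_expect p]
  conv_rhs => rw [← expect_const p ε, ← expect_add]
  refine expect_mono fun a hp => ?_
  rw [← toOuterMeasure_eq_expect]
  by_cases ha : a ∈ s
  · simpa [ha] using h a hp ha
  · calc (q a).toOuterMeasure tᶜ ≤ 1 := by
          rw [← toOuterMeasure_add_compl (q a) t]; exact le_add_self
      _ ≤ _ := by simp [ha]

end expect

/-! ### Independent draws -/

theorem expect_indep_prod {α : Type} : ∀ (k : ℕ) (p : Fin k → PMF α) (f : Fin k → α → ℝ≥0∞),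
    expect (indep k p) (fun c => ∏ i, f i (c i)) = ∏ i, expect (p i) (f i)
  | 0, p, f => by simp [indep, expect_pure]
  | k + 1, p, f => by
    simp only [indep, expect_bind, expect_pure, Fin.prod_univ_succ, Fin.cons_zero, Fin.cons_succ,
      expect_const_mul]
    rw [expect_indep_prod k (fun i => p i.succ) (fun i => f i.succ)]
    simp_rw [mul_comm _ (∏ i : Fin k, _), expect_const_mul]

theorem expect_indep_prod_finset {α : Type} {k : ℕ} (p : Fin k → PMF α) (A : Finset (Fin k))
    (f : Fin k → α → ℝ≥0∞) :
    expect (indep k p) (fun c => ∏ i ∈ A, f i (c i)) = ∏ i ∈ A, expect (p i) (f i) := by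
  classical
  -- Factors outside `A` are set to 1, which does not change either product.
  have h := expect_indep_prod k p (fun i => if i ∈ A then f i else fun _ => 1)
  have e (g : Fin k → ℝ≥0∞) : ∏ i, (if i ∈ A then g i else 1) = ∏ i ∈ A, g i := by
    rw [Finset.prod_ite_mem]; simp
  rw [← e, ← show ∏ i, expect (p i) (if i ∈ A then f i else fun _ => 1) =
    ∏ i, (if i ∈ A then expect (p i) (f i) else 1) from Finset.prod_congr rfl fun i _ => by
      split_ifs <;> simp [expect_const], ← h]
  congr 1
  funext c
  rw [← e]
  exact Finset.prod_congr rfl fun i _ => by split_ifs <;> rfl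

/-- The probability of a product event. -/
theorem toOuterMeasure_indep_forall {α : Type} {k : ℕ} (p : Fin k → PMF α) (A : Finset (Fin k))
    (B : Fin k → Set α) :
    (indep k p).toOuterMeasure {c | ∀ i ∈ A, c i ∈ B i} = ∏ i ∈ A, (p i).toOuterMeasure (B i) := by
  classical
  simp only [toOuterMeasure_eq_expect]
  rw [← expect_indep_prod_finset]
  congr 1
  funext c
  by_cases h : ∀ i ∈ A, c i ∈ B i
  · rw [Set.indicator_of_mem (by exact h), Finset.prod_eq_one fun i hi => by simp [h i hi]]
    rfl
  · rw [Set.indicator_of_notMem (by exact h)]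
    push Not at h
    obtain ⟨i, hi, hB⟩ := h
    exact (Finset.prod_eq_zero hi (by simp [hB])).symm

/-- Leaving the support in one coordinate is a product event with a single factor, and that factor
is 0. -/
theorem mem_support_of_mem_support_indep {α : Type} {k : ℕ} {p : Fin k → PMF α} {c : Fin k → α}
    (hc : c ∈ (indep k p).support) (i : Fin k) : c i ∈ (p i).support := by
  by_contra h
  have := toOuterMeasure_indep_forall p {i} fun i => (p i).supportᶜ
  simp only [Finset.mem_singleton, forall_eq, Finset.prod_singleton] at this
  rw [(PMF.toOuterMeasure_apply_eq_zero_iff _ (p i).supportᶜ).2 disjoint_compl_right,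
    PMF.toOuterMeasure_apply_eq_zero_iff] at this
  exact Set.disjoint_left.1 this hc h

theorem toOuterMeasure_draws_forall {α : Type} (p : PMF α) (B : Set α) :
    ∀ m, (draws p m).toOuterMeasure {l | ∀ x ∈ l, x ∈ B} = p.toOuterMeasure B ^ m
  | 0 => by
    rw [toOuterMeasure_eq_expect, draws, expect_pure]
    simp
  | m + 1 => by
    classical
    have ih := toOuterMeasure_draws_forall p B m
    rw [toOuterMeasure_eq_expect] at ih ⊢
    simp only [draws, expect_bind, expect_pure]
    have (a : α) (l : List α) : Set.indicator {l | ∀ x ∈ l, x ∈ B} (1 : List α → ℝ≥0∞) (a :: l) =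
        B.indicator 1 a * Set.indicator {l | ∀ x ∈ l, x ∈ B} 1 l := by
      by_cases ha : a ∈ B <;> simp [Set.indicator, ha]
    simp only [this, expect_const_mul, ih]
    simp only [mul_comm _ (p.toOuterMeasure B ^ m)]
    rw [expect_const_mul, ← toOuterMeasure_eq_expect, pow_succ]

theorem length_of_mem_support_draws {α : Type} {p : PMF α} :
    ∀ {m : ℕ} {l : List α}, l ∈ (draws p m).support → l.length = m
  | 0, l, h => by simp_all [draws]
  | m + 1, l, h => by
    simp only [draws, PMF.mem_support_bind_iff, PMF.mem_support_pure_iff] at h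
    obtain ⟨a, -, l', hl', rfl⟩ := h
    simp [length_of_mem_support_draws hl']

theorem length_le_of_mem_support_sample {α : Type} {S : Multiset α} {m : ℕ} {l : List α}
    (h : l ∈ (sample S m).support) : l.length ≤ m := by
  unfold sample at h
  split_ifs at h
  · simp_all
  · exact (length_of_mem_support_draws h).le

open Classical in
theorem toOuterMeasure_ofMultiset_eq {α : Type} (S : Multiset α) (hS : S ≠ 0) (B : Set α) :
    (PMF.ofMultiset S hS).toOuterMeasure B = (S.filter (· ∈ B)).card / S.card := by
  rw [PMF.toOuterMeasure_ofMultiset_apply]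
  congr 1
  rw [tsum_eq_sum (s := (S.filter (· ∈ B)).toFinset) (by
    intro b hb; simpa using hb)]
  exact_mod_cast Multiset.toFinset_sum_count_eq _

/-- A sample of size `m` misses a set that contains at least `g` of the at most `κ` entries of the
array with probability at most `exp (- g m / κ)`. -/
theorem toOuterMeasure_sample_miss_le {α : Type} (S : Multiset α) (m : ℕ) (B : Set α)
    [DecidablePred (· ∈ B)] {g κ : ℕ} (hg : 0 < g) (hB : g ≤ (S.filter (· ∈ B)).card)
    (hκ : S.card ≤ κ) :
    (sample S m).toOuterMeasure {l | ∀ x ∈ l, x ∉ B} ≤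
      ENNReal.ofReal (Real.exp (-((g : ℝ) / κ * m))) := by
  have hle : (S.filter (· ∈ B)).card ≤ S.card := Multiset.card_le_card (Multiset.filter_le _ _)
  have hS0 : 0 < S.card := by omega
  have hS : S ≠ 0 := Multiset.card_pos.1 hS0
  have h1 := toOuterMeasure_draws_forall (PMF.ofMultiset S hS) Bᶜ m
  simp only [Set.mem_compl_iff] at h1
  rw [sample, dif_neg hS, h1]
  have hsum : (S.filter (· ∈ B)).card + (S.filter (· ∉ B)).card = S.card := by
    rw [← Multiset.card_add, Multiset.filter_add_not]
  have hκ0 : (0 : ℝ) < κ := by exact_mod_cast (show 0 < κ by omega)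
  have hSr : (0 : ℝ) < S.card := by exact_mod_cast hS0
  -- The missing fraction is at most 1 - g/κ, and 1 - y ≤ exp(-y).
  have key : ((S.filter (· ∉ B)).card : ℝ) / S.card ≤ Real.exp (-((g : ℝ) / κ)) := by
    refine le_trans ?_ (Real.add_one_le_exp _)
    have h2 : ((S.filter (· ∉ B)).card : ℝ) = S.card - (S.filter (· ∈ B)).card := by
      rw [← hsum]; push_cast; ring
    rw [h2, sub_div, div_self hSr.ne']
    have : (g : ℝ) / κ ≤ ((S.filter (· ∈ B)).card : ℝ) / S.card := by
      refine div_le_div₀ (Nat.cast_nonneg _) (by exact_mod_cast hB) hSr (by exact_mod_cast hκ)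
    linarith
  have h3 : (PMF.ofMultiset S hS).toOuterMeasure Bᶜ ≤
      ENNReal.ofReal (Real.exp (-((g : ℝ) / κ))) := by
    rw [toOuterMeasure_ofMultiset_eq]
    refine le_trans (le_of_eq ?_) (ENNReal.ofReal_le_ofReal key)
    rw [ENNReal.ofReal_div_of_pos hSr, ENNReal.ofReal_natCast, ENNReal.ofReal_natCast]
    congr!
  refine (pow_le_pow_left' h3 m).trans (le_of_eq ?_)
  rw [← ENNReal.ofReal_pow (Real.exp_pos _).le, ← Real.exp_nat_mul]
  congr 2
  ring

/-! ### Lower tails of the number of successes -/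

open Classical in
/-- Chernoff bound: if each of the independent trials in `A` fails with probability at most `ρ`,
then there are at most `T` successes with probability at most
`exp (u T) (exp (-u) + (1 - exp (-u)) ρ) ^ |A|`, for all `u ≥ 0`. -/
theorem toOuterMeasure_indep_card_le {α : Type} {k : ℕ} (p : Fin k → PMF α) (A : Finset (Fin k))
    (B : Fin k → Set α) {ρ u T : ℝ} (hρ : 0 ≤ ρ) (hu : 0 ≤ u)
    (hmiss : ∀ i ∈ A, (p i).toOuterMeasure (B i)ᶜ ≤ ENNReal.ofReal ρ) :
    (indep k p).toOuterMeasure {c | ((A.filter fun i => c i ∈ B i).card : ℝ) ≤ T} ≤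
      ENNReal.ofReal (Real.exp (u * T) *
        (Real.exp (-u) + (1 - Real.exp (-u)) * ρ) ^ A.card) := by
  set θ := Real.exp (-u) with hθ
  have hθ0 : 0 < θ := Real.exp_pos _
  have hθ1 : θ ≤ 1 := Real.exp_le_one_iff.2 (by linarith)
  -- Each success is discounted by θ = exp(-u), so one trial has mean θ + (1 - θ) P(miss).
  let f : Fin k → α → ℝ≥0∞ := fun i a => if a ∈ B i then ENNReal.ofReal θ else 1
  have hf (i : Fin k) (hi : i ∈ A) : expect (p i) (f i) ≤ ENNReal.ofReal (θ + (1 - θ) * ρ) := by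
    have h1 : expect (p i) (f i) = ENNReal.ofReal θ + ENNReal.ofReal (1 - θ) *
        (p i).toOuterMeasure (B i)ᶜ := by
      rw [toOuterMeasure_eq_expect, ← expect_const_mul, ← expect_const (p i) (ENNReal.ofReal θ),
        ← expect_add]
      congr 1
      funext a
      by_cases ha : a ∈ B i
      · simp [f, ha]
      · simp only [ha, ↓reduceIte, f, Set.mem_compl_iff, not_false_eq_true,
          Set.indicator_of_mem, Pi.one_apply, mul_one]
        rw [← ENNReal.ofReal_add hθ0.le (by linarith)]
        simp
    rw [h1, ENNReal.ofReal_add hθ0.le (mul_nonneg (by linarith) hρ),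
      ENNReal.ofReal_mul (by linarith)]
    gcongr
    exact hmiss i hi
  have hmarkov : (indep k p).toOuterMeasure {c | ((A.filter fun i => c i ∈ B i).card : ℝ) ≤ T} ≤
      expect (indep k p) fun c => ENNReal.ofReal (Real.exp (u * T)) * ∏ i ∈ A, f i (c i) := by
    refine toOuterMeasure_le_of_one_le fun c hc => ?_
    have : ∏ i ∈ A, f i (c i) = ENNReal.ofReal θ ^ (A.filter fun i => c i ∈ B i).card := by
      simp only [f]
      rw [← Finset.prod_filter, Finset.prod_const]
    -- The weighted product is exp(u (T - successes)), at least 1 on the event.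
    rw [this, ← ENNReal.ofReal_pow hθ0.le, ← ENNReal.ofReal_mul (Real.exp_pos _).le,
      ENNReal.one_le_ofReal, hθ, ← Real.exp_nat_mul, ← Real.exp_add, Real.one_le_exp_iff]
    have := mul_le_mul_of_nonneg_left (show (_ : ℝ) ≤ T from hc) hu
    linarith
  refine hmarkov.trans ?_
  rw [expect_const_mul, expect_indep_prod_finset, ENNReal.ofReal_mul (Real.exp_pos _).le,
    ENNReal.ofReal_pow (by nlinarith)]
  gcongr
  exact Finset.prod_le_pow_card _ _ _ hf

/-- By convexity the exponential lies below its chord over [-3, 0]; bounding e^(-3) by 1/20 gives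
the slope (1 - 1/20)/3 = 19/60. -/
theorem exp_neg_le_of_le_three {x : ℝ} (h0 : 0 ≤ x) (h3 : x ≤ 3) :
    Real.exp (-x) ≤ 1 - 19 / 60 * x := by
  have hc := convexOn_exp.2 (Set.mem_univ 0) (Set.mem_univ (-3))
    (show 0 ≤ 1 - x / 3 by linarith) (show 0 ≤ x / 3 by linarith) (by ring)
  have he : Real.exp (-3) ≤ 1 / 20 := by
    rw [Real.exp_neg, inv_le_comm₀ (Real.exp_pos _) (by norm_num)]
    have h1 := Real.exp_one_gt_d9
    rw [show (3 : ℝ) = (3 : ℕ) * 1 by norm_num, Real.exp_nat_mul]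
    calc (1 / 20 : ℝ)⁻¹ ≤ 2.718 ^ 3 := by norm_num
      _ ≤ Real.exp 1 ^ 3 := pow_le_pow_left₀ (by norm_num) (by linarith) 3
  simp only [smul_eq_mul, mul_zero, zero_add, Real.exp_zero, mul_one] at hc
  rw [show x / 3 * -3 = -x by ring] at hc
  nlinarith

open Classical in
/-- If `g` of `k` senders spread a verified index and at least `D` receivers are active, then with
high probability at least `min (2 * g) (D / 2)` of the receivers obtain a verified index. -/
theorem toOuterMeasure_indep_card_lt_of_miss {α : Type} {k : ℕ} (p : Fin k → PMF α)
    (A : Finset (Fin k)) (B : Fin k → Set α) {Λ D x T : ℝ} {g : ℕ} (hΛ : 20 ≤ Λ) (hD : 0 < D)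
    (hg : 0 < g) (hA : D ≤ A.card) (hT : T ≤ 2 * g) (hTD : T ≤ D / 2) (hx : x * D = 8 * g * Λ)
    (hmiss : ∀ i ∈ A, (p i).toOuterMeasure (B i)ᶜ ≤ ENNReal.ofReal (Real.exp (-x))) :
    (indep k p).toOuterMeasure {c | ((A.filter fun i => c i ∈ B i).card : ℝ) < T} ≤
      ENNReal.ofReal (Real.exp (-(2 * Λ))) := by
  have hg1 : (1 : ℝ) ≤ g := by exact_mod_cast hg
  have hgΛ : Λ ≤ g * Λ := by nlinarith
  have hx0 : 0 < x := by
    by_contra h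
    nlinarith
  have hxA : 8 * (g * Λ) ≤ x * A.card := by nlinarith
  have hln := Real.log_two_lt_d9
  have hexp : Real.exp (-x) ≤ 1 := Real.exp_le_one_iff.2 (by linarith)
  refine (MeasureTheory.measure_mono
      (t := {c : Fin k → α | ((A.filter fun i => c i ∈ B i).card : ℝ) ≤ T})
      fun c hc => le_of_lt (show _ < T from hc)).trans ?_
  -- For x ≥ 3 misses are rare, and the tilt u = x with T ≤ D/2 suffices. For x ≤ 3 the fixed tilt u
  -- = 4 ln 2 with T ≤ 2g does.
  rcases le_total 3 x with h3 | h3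
  · refine (toOuterMeasure_indep_card_le p A B (Real.exp_pos (-x)).le hx0.le hmiss).trans
      (ENNReal.ofReal_le_ofReal ?_)
    have h1 : Real.exp (-x) + (1 - Real.exp (-x)) * Real.exp (-x) ≤
        Real.exp (Real.log 2 - x) := by
      rw [sub_eq_add_neg (Real.log 2), Real.exp_add, Real.exp_log (by norm_num)]
      nlinarith [Real.exp_pos (-x)]
    have h0 : 0 ≤ Real.exp (-x) + (1 - Real.exp (-x)) * Real.exp (-x) := by
      nlinarith [Real.exp_pos (-x)]
    calc _ ≤ Real.exp (x * T) * Real.exp (Real.log 2 - x) ^ A.card := by gcongr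
      _ = Real.exp (x * T + A.card * (Real.log 2 - x)) := by
        rw [← Real.exp_nat_mul, ← Real.exp_add]
      _ ≤ _ := by
        rw [Real.exp_le_exp]
        have e1 : x * T ≤ x * A.card / 2 := by nlinarith
        -- Here ln 2 ≤ 0.2311 · 3 ≤ 0.2311 x. The exponent is then at most -(1 - 0.5 - 0.2311) ·
        -- 8gΛ, below -2Λ.
        have e2 : (A.card : ℝ) * Real.log 2 ≤ 0.2311 * (x * A.card) := by nlinarith
        nlinarith
  · have hu : 0 ≤ 4 * Real.log 2 := by positivity
    refine (toOuterMeasure_indep_card_le p A B (Real.exp_pos (-x)).le hu hmiss).trans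
      (ENNReal.ofReal_le_ofReal ?_)
    have hθ : Real.exp (-(4 * Real.log 2)) = 1 / 16 := by
      rw [Real.exp_neg, show (4 : ℝ) * Real.log 2 = (4 : ℕ) * Real.log 2 by norm_num,
        Real.exp_nat_mul, Real.exp_log (by norm_num)]
      norm_num
    have h2 := exp_neg_le_of_le_three hx0.le h3
    -- The left side is 1/16 + (15/16) e^(-x), and 15/16 · 19/60 = 19/64.
    have h1 : Real.exp (-(4 * Real.log 2)) + (1 - Real.exp (-(4 * Real.log 2))) * Real.exp (-x) ≤
        Real.exp (-(19 / 64 * x)) := by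
      refine le_trans ?_ (Real.add_one_le_exp _)
      rw [hθ]
      linarith
    have h0 : 0 ≤ Real.exp (-(4 * Real.log 2)) +
        (1 - Real.exp (-(4 * Real.log 2))) * Real.exp (-x) := by
      rw [hθ]
      nlinarith [Real.exp_pos (-x)]
    calc _ ≤ Real.exp (4 * Real.log 2 * T) * Real.exp (-(19 / 64 * x)) ^ A.card := by gcongr
      _ = Real.exp (4 * Real.log 2 * T + A.card * (-(19 / 64 * x))) := by
        rw [← Real.exp_nat_mul, ← Real.exp_add]
      _ ≤ _ := by
        rw [Real.exp_le_exp]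
        have e1 : 4 * Real.log 2 * T ≤ 4 * Real.log 2 * (2 * g) := by gcongr
        -- The exponent is at most 5.6 g - (19/8) gΛ. Since Λ ≥ 20, the surplus (3/8) gΛ ≥ 7.5 g
        -- pays for the first term.
        have e2 : 4 * Real.log 2 * (2 * g) ≤ 5.6 * g := by nlinarith
        nlinarith

open Classical in
/-- The union bound for the failure of one of the trials in `A`. -/
theorem toOuterMeasure_indep_exists_le {α : Type} {k : ℕ} (p : Fin k → PMF α)
    (A : Finset (Fin k)) (B : Fin k → Set α) {ρ : ℝ≥0∞}
    (hmiss : ∀ i ∈ A, (p i).toOuterMeasure (B i)ᶜ ≤ ρ) :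
    (indep k p).toOuterMeasure {c | ∃ i ∈ A, c i ∉ B i} ≤ k * ρ := by
  have h : {c : Fin k → α | ∃ i ∈ A, c i ∉ B i} =
      ⋃ i ∈ A, {c | ∀ j ∈ ({i} : Finset (Fin k)), c j ∈ (B j)ᶜ} := by
    ext c; simp
  rw [h]
  refine (MeasureTheory.measure_biUnion_finset_le A _).trans ?_
  calc _ ≤ ∑ i ∈ A, ρ := by
        refine Finset.sum_le_sum fun i hi => ?_
        rw [toOuterMeasure_indep_forall, Finset.prod_singleton]
        exact hmiss i hi
    _ = A.card * ρ := by simp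
    _ ≤ k * ρ := by
        gcongr
        exact_mod_cast (Finset.card_le_univ A).trans_eq (Fintype.card_fin k)

variable {k n : ℕ} {γ : ℝ} {pick : Fin k → ℕ → ℕ → Finset (Fin n) → Fin n}

/-! ### One round of the algorithm -/

/-- The current state of machine `i`. -/
noncomputable def History.rd (h : History (randomizedDisjunction k n γ pick)) (i : Fin k) : RDState k n :=
  h.state i

/-- The state of a machine in the middle of a round, if it queried `c`. -/
def RDState.mid (X : Fin n → Bool) (σ : RDState k n) (c : List (Fin n)) : RDState k n :=
  σ.learn (c.map fun x => (x, X x))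

section mid

variable (X : Fin n → Bool) (σ : RDState k n) (c : List (Fin n))

@[simp] theorem RDState.mid_r : (σ.mid X c).r = σ.r := rfl

@[simp] theorem RDState.mid_s : (σ.mid X c).s = σ.s := rfl

theorem RDState.mem_mid_K {x : Fin n} : x ∈ (σ.mid X c).K ↔ x ∈ σ.K ∨ x ∈ c ∧ X x = true := by
  simp only [mid, learn, Finset.mem_union, List.mem_toFinset, List.mem_map, List.mem_filter]
  refine or_congr Iff.rfl ⟨?_, ?_⟩
  · rintro ⟨a, ⟨⟨y, hy, rfl⟩, h⟩, rfl⟩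
    exact ⟨hy, h⟩
  · rintro ⟨h, hx⟩
    exact ⟨(x, X x), ⟨⟨x, h, rfl⟩, hx⟩, rfl⟩

theorem RDState.mid_K_nonempty (h : σ.K.Nonempty) : (σ.mid X c).K.Nonempty := by
  obtain ⟨x, hx⟩ := h
  exact ⟨x, (σ.mem_mid_K X c).2 (Or.inl hx)⟩

theorem RDState.mid_found :
    (σ.mid X c).found = if σ.s = 0 then decide (σ.mid X c).K.Nonempty else σ.found := rfl

theorem RDState.mid_out :
    (σ.mid X c).out = if σ.s < Nat.clog 2 k then none
      else if (σ.mid X c).found then some true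
      else if σ.r < Nat.clog 2 n then none
      else some (decide (σ.mid X c).K.Nonempty) := rfl

theorem RDState.mid_found_nonempty (h : σ.found = true → σ.K.Nonempty)
    (hf : (σ.mid X c).found = true) : (σ.mid X c).K.Nonempty := by
  rw [RDState.mid_found] at hf
  split_ifs at hf
  · exact of_decide_eq_true hf
  · exact σ.mid_K_nonempty X c (h hf)

end mid

section receive

variable (σ : RDState k n) (inbox : Fin k → Option (Fin n))

@[simp] theorem RDState.receive_K : (σ.receive inbox).K = σ.K := by
  unfold receive; split_ifs <;> rfl

@[simp] theorem RDState.receive_found : (σ.receive inbox).found = σ.found := by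
  unfold receive; split_ifs <;> rfl

@[simp] theorem RDState.receive_out : (σ.receive inbox).out = σ.out := by
  unfold receive; split_ifs <;> rfl

@[simp] theorem RDState.receive_inbox : (σ.receive inbox).inbox = inbox := by
  unfold receive; split_ifs <;> rfl

theorem RDState.receive_r_of_lt (h : σ.s < Nat.clog 2 k) : (σ.receive inbox).r = σ.r := by
  simp [receive, h]

theorem RDState.receive_s_of_lt (h : σ.s < Nat.clog 2 k) : (σ.receive inbox).s = σ.s + 1 := by
  simp [receive, h]

theorem RDState.receive_r_of_le (h : Nat.clog 2 k ≤ σ.s) : (σ.receive inbox).r = σ.r + 1 := by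
  simp [receive, h.not_gt]

theorem RDState.receive_s_of_le (h : Nat.clog 2 k ≤ σ.s) : (σ.receive inbox).s = 0 := by
  simp [receive, h.not_gt]

end receive

section round

variable (X : Fin n → Bool) (adv : Adversary (randomizedDisjunction k n γ pick)) (b : ℕ)
  (h : History (randomizedDisjunction k n γ pick)) (c : Fin k → List (Fin n))

/-- The history extended by the round with the random values `c`. -/
noncomputable def History.extend : History (randomizedDisjunction k n γ pick) :=
  nextRound (randomizedDisjunction k n γ pick) X adv b h c :: h

theorem active_iff {i : Fin k} :
    Active adv b h i ↔ i ∉ adv.nextCorrupted b h ∧ (h.rd i).out = none := Iff.rfl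

theorem corrupted_extend : (h.extend X adv b c).corrupted = adv.nextCorrupted b h := rfl

theorem corrupted_subset_nextCorrupted : h.corrupted ⊆ adv.nextCorrupted b h := by
  unfold Adversary.nextCorrupted
  split_ifs
  · exact Finset.subset_union_left
  · exact subset_rfl

theorem card_nextCorrupted_le (hc : h.corrupted.card ≤ b) : (adv.nextCorrupted b h).card ≤ b := by
  unfold Adversary.nextCorrupted
  split_ifs with h'
  · exact h'
  · exact hc

/-- The message from `i` to `j` in the round with the random values `c`. -/
noncomputable def History.nextMsg (i j : Fin k) : Option (Fin n) :=
  (nextRound (randomizedDisjunction k n γ pick) X adv b h c).msg i j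

variable {adv b h}

theorem rd_extend_of_active {i : Fin k} (hi : Active adv b h i) :
    (h.extend X adv b c).rd i =
      ((h.rd i).mid X (c i)).receive fun j => h.nextMsg X adv b c j i := by
  simp only [History.extend, History.rd, History.state, nextRound, hi, if_true, RDState.mid]
  rfl

theorem rd_extend_of_not_active {i : Fin k} (hi : ¬ Active adv b h i) :
    (h.extend X adv b c).rd i = h.rd i := by
  simp only [History.extend, History.rd, History.state, nextRound, hi, if_false]
  rfl

theorem nextMsg_of_active {i j : Fin k} (hi : Active adv b h i) (hij : i ≠ j) :
    h.nextMsg X adv b c i j = ((h.rd i).mid X (c i)).send pick := by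
  have := hi.1
  simp only [History.nextMsg, nextRound, hi, if_true, hij, if_false, this, RDState.mid]
  rfl

theorem nextMsg_of_not_active {i j : Fin k} (hi : i ∉ adv.nextCorrupted b h)
    (hi' : ¬ Active adv b h i) : h.nextMsg X adv b c i j = none := by
  simp only [History.nextMsg, nextRound, hi, hi', if_false, ite_self]

theorem queries_extend_of_active {i : Fin k} (hi : Active adv b h i) :
    (h.extend X adv b c).queries i = (c i).length + h.queries i := by
  simp only [History.extend, History.queries, List.map_cons, List.sum_cons, nextRound, hi, if_true]
  rfl

theorem queries_extend_of_not_active {i : Fin k} (hi : ¬ Active adv b h i) :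
    (h.extend X adv b c).queries i = h.queries i := by
  simp [History.extend, History.queries, nextRound, hi]

end round

/-! ### Message counts per machine -/

/-- The number of messages sent so far by machine `i`. -/
def History.sent {P : Protocol k n} (h : History P) (i : Fin k) : ℕ :=
  (h.map fun R => (Finset.univ.filter fun j => (R.msg i j).isSome).card).sum

theorem History.messages_eq_sum_sent {P : Protocol k n} (h : History P) :
    h.messages = ∑ i ∈ (History.corrupted h)ᶜ, h.sent i := by
  unfold History.messages
  -- The summation set belongs to the whole history and must stay fixed while the induction removes
  -- rounds.
  generalize (History.corrupted h)ᶜ = A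
  induction h with
  | nil => simp [History.sent]
  | cons R h ih =>
    rw [List.map_cons, List.sum_cons, ih, ← Finset.sum_add_distrib]
    simp [History.sent]

section sent

variable (X : Fin n → Bool) {adv : Adversary (randomizedDisjunction k n γ pick)} {b : ℕ}
  {h : History (randomizedDisjunction k n γ pick)} (c : Fin k → List (Fin n))

theorem sent_extend (i : Fin k) : (h.extend X adv b c).sent i =
    (Finset.univ.filter fun j => (h.nextMsg X adv b c i j).isSome).card + h.sent i := by
  simp only [History.sent, History.extend, List.map_cons, List.sum_cons]
  rfl

theorem sent_extend_le (i : Fin k) : (h.extend X adv b c).sent i ≤ k + h.sent i := by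
  rw [sent_extend]
  gcongr
  exact (Finset.card_le_univ _).trans_eq (Fintype.card_fin k)

theorem sent_extend_of_not_active {i : Fin k} (hi : i ∉ adv.nextCorrupted b h)
    (hi' : ¬ Active adv b h i) : (h.extend X adv b c).sent i = h.sent i := by
  rw [sent_extend]
  simp [nextMsg_of_not_active X c hi hi']

end sent

/-! ### Properties that hold with certainty -/

/-- The number of indices drawn in step 1 of iteration `r`. -/
noncomputable def mainDraws (k n : ℕ) (γ : ℝ) (r : ℕ) : ℕ :=
  ⌈2 ^ r * (1 / (γ * k)) * Real.log n⌉₊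

/-- The number of entries drawn in a phase of `Spread`. -/
noncomputable def spreadDraws (n : ℕ) (γ : ℝ) : ℕ := ⌈8 * Real.log n / γ⌉₊

/-- A bound for the number of queries before round `s` of iteration `r`. -/
noncomputable def queryBudget (k n : ℕ) (γ : ℝ) (r s : ℕ) : ℕ :=
  ∑ q ∈ Finset.Ico 1 r, mainDraws k n γ q + (if s = 0 then 0 else mainDraws k n γ r) +
    (r * (Nat.clog 2 k + 1) + s) * spreadDraws n γ

/-- The invariant of a machine `i` that has followed the protocol for `t` rounds. -/
structure Accounted (X : Fin n → Bool) (t : ℕ) (h : History (randomizedDisjunction k n γ pick))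
    (i : Fin k) : Prop where
  one_le_r : 1 ≤ (h.rd i).r
  r_le : (h.rd i).r ≤ Nat.clog 2 n + 1
  s_le : (h.rd i).s ≤ Nat.clog 2 k
  verified : ∀ x ∈ (h.rd i).K, X x = true
  found : (h.rd i).found = true → (h.rd i).K.Nonempty
  out_true : (h.rd i).out = some true → (h.rd i).K.Nonempty
  time : (h.rd i).out = none →
    t + (Nat.clog 2 k + 1) = (h.rd i).r * (Nat.clog 2 k + 1) + (h.rd i).s
  r_le_of_none : (h.rd i).out = none → (h.rd i).r ≤ Nat.clog 2 n
  queries : h.queries i ≤ queryBudget k n γ (h.rd i).r (h.rd i).s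
  sent : h.sent i ≤ k * ((h.rd i).r * (Nat.clog 2 k + 1) + (h.rd i).s)

theorem accounted_nil (X : Fin n → Bool) (hn : 2 ≤ n) (i : Fin k) :
    Accounted X 0 ([] : History (randomizedDisjunction k n γ pick)) i := by
  have hN : 1 ≤ Nat.clog 2 n := Nat.clog_pos (by norm_num) hn
  constructor <;> simp_all [History.rd, History.state, randomizedDisjunction, History.queries,
    History.sent]

/-- A terminated machine is frozen. For a running one, each round advances the clock encoded by `r`
and `s` by one, and the allowances for queries and messages grow by at least what the round can
cost. -/
theorem Accounted.extend {X : Fin n → Bool} {adv : Adversary (randomizedDisjunction k n γ pick)}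
    {b t : ℕ} {h : History (randomizedDisjunction k n γ pick)} {c : Fin k → List (Fin n)}
    {i : Fin k} (hk : 2 ≤ k) (ha : Accounted X t h i) (hi : i ∉ adv.nextCorrupted b h)
    (hc : (c i).length ≤
      if (h.rd i).s = 0 then mainDraws k n γ (h.rd i).r else spreadDraws n γ) :
    Accounted X (t + 1) (h.extend X adv b c) i := by
  have hL : 0 < Nat.clog 2 k := Nat.clog_pos (by norm_num) hk
  by_cases hact : Active adv b h i
  · have hout : (h.rd i).out = none := hact.2
    have htime := ha.time hout
    have hr := ha.one_le_r
    have hq := ha.queries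
    have hse := (sent_extend_le (adv := adv) (b := b) (h := h) X c i).trans
      (Nat.add_le_add_left ha.sent k)
    have hmid := (h.rd i).mid_found_nonempty X (c i) ha.found
    have hmo : ((h.rd i).mid X (c i)).out = some true → ((h.rd i).mid X (c i)).K.Nonempty := by
      rw [RDState.mid_out]
      split_ifs with h1 h2 h3
      · simp
      · exact fun _ => hmid h2
      · simp
      · simp
    have hver : ∀ x ∈ ((h.rd i).mid X (c i)).K, X x = true := by
      intro x hx
      rcases ((h.rd i).mem_mid_K X (c i)).1 hx with hx | hx
      exacts [ha.verified x hx, hx.2]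
    have hrd := rd_extend_of_active X c hact
    have hqe := queries_extend_of_active X c hact
    rcases lt_or_ge (h.rd i).s (Nat.clog 2 k) with hs | hs
    · have er := ((h.rd i).mid X (c i)).receive_r_of_lt
        (fun j => h.nextMsg X adv b c j i) hs
      have es := ((h.rd i).mid X (c i)).receive_s_of_lt
        (fun j => h.nextMsg X adv b c j i) hs
      rw [RDState.mid_r] at er
      rw [RDState.mid_s] at es
      constructor
      · rw [hrd, er]; exact hr
      · rw [hrd, er]; exact ha.r_le
      · rw [hrd, es]; exact hs
      · rw [hrd, RDState.receive_K]; exact hver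
      · rw [hrd, RDState.receive_K, RDState.receive_found]; exact hmid
      · rw [hrd, RDState.receive_K, RDState.receive_out]; exact hmo
      · intro _
        rw [hrd, er, es]; omega
      · intro _
        rw [hrd, er]; exact ha.r_le_of_none hout
      · rw [hqe, hrd, er, es]
        unfold queryBudget at hq ⊢
        rw [← add_assoc, add_mul _ 1, if_neg (Nat.succ_ne_zero _)]
        -- Round 0 is paid by the main draws of iteration `r`, which enter the budget once `s` is
        -- nonzero; a later round is paid by the increment of the spread term.
        split_ifs at hc hq <;> omega
      · rw [hrd, er, es]
        refine hse.trans (le_of_eq ?_)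
        ring
    · have er := ((h.rd i).mid X (c i)).receive_r_of_le
        (fun j => h.nextMsg X adv b c j i) hs
      have es := ((h.rd i).mid X (c i)).receive_s_of_le
        (fun j => h.nextMsg X adv b c j i) hs
      rw [RDState.mid_r] at er
      have hsL : (h.rd i).s = Nat.clog 2 k := le_antisymm ha.s_le hs
      constructor
      · rw [hrd, er]; omega
      · rw [hrd, er]; exact Nat.succ_le_succ (ha.r_le_of_none hout)
      · rw [hrd, es]; exact Nat.zero_le _
      · rw [hrd, RDState.receive_K]; exact hver
      · rw [hrd, RDState.receive_K, RDState.receive_found]; exact hmid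
      · rw [hrd, RDState.receive_K, RDState.receive_out]; exact hmo
      · intro _
        rw [hrd, er, es, add_mul]; omega
      · rw [hrd, er, RDState.receive_out, RDState.mid_out, if_neg hs.not_gt]
        split_ifs with h1 h2
        · simp
        · exact fun _ => h2
        · simp
      · rw [hqe, hrd, er, es]
        unfold queryBudget at hq ⊢
        -- The main draws of the finished iteration move from the conditional term into the sum.
        rw [Finset.sum_Ico_succ_top hr, if_pos rfl]
        rw [if_neg (by omega)] at hc hq
        have : ((h.rd i).r + 1) * (Nat.clog 2 k + 1) + 0 =
          (h.rd i).r * (Nat.clog 2 k + 1) + (h.rd i).s + 1 := by rw [hsL]; ring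
        rw [this, add_mul _ 1]
        omega
      · rw [hrd, er, es]
        refine hse.trans (le_of_eq ?_)
        rw [hsL]; ring
  · have hout : (h.rd i).out ≠ none := fun e => hact ⟨hi, e⟩
    have hrd := rd_extend_of_not_active X c hact
    constructor
    · rw [hrd]; exact ha.one_le_r
    · rw [hrd]; exact ha.r_le
    · rw [hrd]; exact ha.s_le
    · rw [hrd]; exact ha.verified
    · rw [hrd]; exact ha.found
    · rw [hrd]; exact ha.out_true
    · rw [hrd]; exact fun e => absurd e hout
    · rw [hrd]; exact fun e => absurd e hout
    · rw [hrd, queries_extend_of_not_active X c hact]; exact ha.queries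
    · rw [hrd, sent_extend_of_not_active X c hi hact]; exact ha.sent

/-! ### Progress of the algorithm on inputs with a one -/

/-- No machine has returned, and none had a verified index in step 2 of the current iteration;
this is not yet iteration `R`, or it is just its beginning. -/
def Searching (R : ℕ) (h : History (randomizedDisjunction k n γ pick)) (r s : ℕ) : Prop :=
  r ≤ R ∧ (r = R → s = 0) ∧ ∀ i ∉ h.corrupted, (h.rd i).r = r ∧ (h.rd i).s = s ∧
    (h.rd i).out = none ∧ (s ≠ 0 → (h.rd i).found = false)

/-- No machine has returned, and each machine without a verified index has received one from all
machines in `H`. -/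
def Spreading (X : Fin n → Bool) (R : ℕ) (h : History (randomizedDisjunction k n γ pick))
    (r s : ℕ) (H : Finset (Fin k)) : Prop :=
  r ≤ R ∧ 1 ≤ s ∧ s ≤ Nat.clog 2 k ∧ min (2 ^ (s - 1) : ℝ) (γ * k / 2) ≤ H.card ∧
    ∀ i ∉ h.corrupted, (h.rd i).r = r ∧ (h.rd i).s = s ∧ (h.rd i).out = none ∧
      ((h.rd i).K.Nonempty ∨ ∀ j ∈ H, ∃ x, (h.rd i).inbox j = some x ∧ X x = true)

/-- Each machine has returned `1`, or has a verified index and returns `1` at the end of the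
iteration after the current `Spread`. -/
def Informed (R : ℕ) (h : History (randomizedDisjunction k n γ pick)) : Prop :=
  ∀ i ∉ h.corrupted, ((h.rd i).out = some true ∧ (h.rd i).r ≤ R + 2) ∨
    ((h.rd i).out = none ∧ (h.rd i).K.Nonempty ∧ (h.rd i).r ≤ R + 1 ∧
      ((h.rd i).s ≠ 0 → (h.rd i).found = true))

/-- The invariant of a successful run on an input with a one. -/
def Progress (X : Fin n → Bool) (R : ℕ) (h : History (randomizedDisjunction k n γ pick)) : Prop :=
  (∃ r s, Searching R h r s) ∨ (∃ r s H, Spreading X R h r s H) ∨ Informed R h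

section steps

variable {X : Fin n → Bool} {adv : Adversary (randomizedDisjunction k n γ pick)} {b t R r s : ℕ}
  {h : History (randomizedDisjunction k n γ pick)} {c : Fin k → List (Fin n)}

/-- The uncorrupted machines that have a verified index after the queries `c`. -/
noncomputable def holders (X : Fin n → Bool) (adv : Adversary (randomizedDisjunction k n γ pick))
    (b : ℕ) (h : History (randomizedDisjunction k n γ pick)) (c : Fin k → List (Fin n)) :
    Finset (Fin k) :=
  (adv.nextCorrupted b h)ᶜ.filter fun i => ((h.rd i).mid X (c i)).K.Nonempty

theorem notMem_corrupted_of_notMem_nextCorrupted {i : Fin k} (hi : i ∉ adv.nextCorrupted b h) :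
    i ∉ h.corrupted :=
  fun hi' => hi (corrupted_subset_nextCorrupted adv b h hi')

/-- No randomness is involved: a nonempty `K` sets `found` in round 0 of the next iteration at the
latest, `found` persists, and the machine returns 1 at the end of that iteration. -/
theorem Informed.extend (hI : Informed R h) : Informed R (h.extend X adv b c) := by
  intro i hi
  rw [corrupted_extend] at hi
  have hic := notMem_corrupted_of_notMem_nextCorrupted hi
  rcases hI i hic with ⟨h1, h2⟩ | ⟨h1, h2, h3, h4⟩
  · have hact : ¬ Active adv b h i := fun ha => by
      have := ((active_iff adv b h).1 ha).2
      simp [h1] at this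
    rw [rd_extend_of_not_active X c hact]
    exact Or.inl ⟨h1, h2⟩
  · have hact : Active adv b h i := ⟨hi, h1⟩
    rw [rd_extend_of_active X c hact, RDState.receive_K, RDState.receive_found,
      RDState.receive_out, RDState.mid_out]
    have hK := (h.rd i).mid_K_nonempty X (c i) h2
    have hf : ((h.rd i).mid X (c i)).found = true := by
      rw [RDState.mid_found]
      split_ifs with h0
      · simpa using hK
      · exact h4 h0
    rcases lt_or_ge (h.rd i).s (Nat.clog 2 k) with hs | hs
    · right
      rw [if_pos hs, RDState.receive_r_of_lt _ _ (by simpa using hs)]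
      exact ⟨rfl, hK, h3, fun _ => hf⟩
    · left
      rw [if_neg hs.not_gt, if_pos hf, RDState.receive_r_of_le _ _ (by simpa using hs)]
      exact ⟨rfl, Nat.succ_le_succ h3⟩

/-- A holder sends in the round of its queries, so corrupting it afterwards cannot withdraw the
message. This is why the set of senders in `Spreading` need not remain uncorrupted. -/
theorem spreading_extend (hpick : ∀ i r s K, K.Nonempty → pick i r s K ∈ K)
    (hacc : ∀ i ∉ h.corrupted, Accounted X t h i) (hr : r ≤ R) (hs : s < Nat.clog 2 k)
    (hall : ∀ i ∉ h.corrupted, (h.rd i).r = r ∧ (h.rd i).s = s ∧ (h.rd i).out = none)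
    (hcard : min (2 ^ s : ℝ) (γ * k / 2) ≤ (holders X adv b h c).card) :
    Spreading X R (h.extend X adv b c) r (s + 1) (holders X adv b h c) := by
  refine ⟨hr, by omega, hs, by simpa using hcard, fun i hi => ?_⟩
  rw [corrupted_extend] at hi
  have hic := notMem_corrupted_of_notMem_nextCorrupted hi
  obtain ⟨h1, h2, h3⟩ := hall i hic
  have hact : Active adv b h i := ⟨hi, h3⟩
  have hs' : ((h.rd i).mid X (c i)).s < Nat.clog 2 k := by simpa [h2] using hs
  rw [rd_extend_of_active X c hact, RDState.receive_K, RDState.receive_out,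
    RDState.receive_r_of_lt _ _ hs', RDState.receive_s_of_lt _ _ hs', RDState.receive_inbox,
    RDState.mid_out]
  refine ⟨h1, by simp [h2], by simp [h2, hs], ?_⟩
  by_cases hK : ((h.rd i).mid X (c i)).K.Nonempty
  · exact Or.inl hK
  · refine Or.inr fun j hj => ?_
    obtain ⟨hj1, hj2⟩ := Finset.mem_filter.1 hj
    rw [Finset.mem_compl] at hj1
    have hjc := notMem_corrupted_of_notMem_nextCorrupted hj1
    obtain ⟨g1, g2, g3⟩ := hall j hjc
    have hji : j ≠ i := by
      rintro rfl
      exact hK hj2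
    rw [nextMsg_of_active X c ⟨hj1, g3⟩ hji, RDState.send,
      if_pos ⟨by simpa [g2] using hs, hj2⟩]
    refine ⟨_, rfl, ?_⟩
    have hm := hpick ((h.rd j).mid X (c j)).id ((h.rd j).mid X (c j)).r ((h.rd j).mid X (c j)).s
      _ hj2
    rcases ((h.rd j).mem_mid_K X (c j)).1 hm with hx | hx
    exacts [(hacc j hjc).verified _ hx, hx.2]

/-- During `Spread`, corrupted senders may hand out genuine ones. This is harmless: `found` was
fixed in round 0, so nobody returns, and the indices count as holdings in the next iteration. -/
theorem Searching.extend (hR : R ≤ Nat.clog 2 n) (hS : Searching R h r s)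
    (h0 : s = 0 → r ≠ R ∧ holders X adv b h c = ∅) :
    ∃ r' s', Searching R (h.extend X adv b c) r' s' := by
  obtain ⟨hrR, hr0, hall⟩ := hS
  -- Since r < R ≤ ⌈log₂ n⌉, the loop is not exhausted and the final return is not reached.
  have hrlt : r < R := lt_of_le_of_ne hrR fun e => (h0 (hr0 e)).1 e
  have hfound (i : Fin k) (hi : i ∉ adv.nextCorrupted b h) :
      ((h.rd i).mid X (c i)).found = false := by
    obtain ⟨h1, h2, h3, h4⟩ := hall i (notMem_corrupted_of_notMem_nextCorrupted hi)
    rw [RDState.mid_found]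
    split_ifs with hs
    · have := (h0 (h2 ▸ hs)).2
      rw [decide_eq_false_iff_not]
      intro hK
      have : i ∈ holders X adv b h c := Finset.mem_filter.2 ⟨Finset.mem_compl.2 hi, hK⟩
      simp_all
    · exact h4 (h2 ▸ hs)
  rcases lt_or_ge s (Nat.clog 2 k) with hs | hs
  · refine ⟨r, s + 1, hrR, fun e => absurd e hrlt.ne, fun i hi => ?_⟩
    rw [corrupted_extend] at hi
    obtain ⟨h1, h2, h3, h4⟩ := hall i (notMem_corrupted_of_notMem_nextCorrupted hi)
    have hs' : ((h.rd i).mid X (c i)).s < Nat.clog 2 k := by simpa [h2] using hs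
    rw [rd_extend_of_active X c ⟨hi, h3⟩, RDState.receive_found, RDState.receive_out,
      RDState.receive_r_of_lt _ _ hs', RDState.receive_s_of_lt _ _ hs', RDState.mid_out]
    exact ⟨h1, by simp [h2], by simp [h2, hs], fun _ => hfound i hi⟩
  · refine ⟨r + 1, 0, hrlt, fun _ => rfl, fun i hi => ?_⟩
    rw [corrupted_extend] at hi
    obtain ⟨h1, h2, h3, h4⟩ := hall i (notMem_corrupted_of_notMem_nextCorrupted hi)
    have hs' : Nat.clog 2 k ≤ ((h.rd i).mid X (c i)).s := by simpa [h2] using hs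
    rw [rd_extend_of_active X c ⟨hi, h3⟩, RDState.receive_found, RDState.receive_out,
      RDState.receive_r_of_le _ _ hs', RDState.receive_s_of_le _ _ hs', RDState.mid_out,
      hfound i hi, if_neg (by omega), if_neg (by simp), if_pos (by omega)]
    exact ⟨by simp [h1], rfl, rfl, fun _ => rfl⟩

theorem Spreading.informed_extend {H : Finset (Fin k)} (hS : Spreading X R h r s H)
    (hs : s = Nat.clog 2 k)
    (hhold : ∀ i ∉ adv.nextCorrupted b h, ((h.rd i).mid X (c i)).K.Nonempty) :
    Informed R (h.extend X adv b c) := by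
  intro i hi
  rw [corrupted_extend] at hi
  obtain ⟨hr, -, -, -, hall⟩ := hS
  obtain ⟨h1, h2, h3, -⟩ := hall i (notMem_corrupted_of_notMem_nextCorrupted hi)
  have hs' : Nat.clog 2 k ≤ ((h.rd i).mid X (c i)).s := by simp [h2, hs]
  have hK := hhold i hi
  rw [rd_extend_of_active X c ⟨hi, h3⟩, RDState.receive_out, RDState.receive_K,
    RDState.receive_r_of_le _ _ hs', RDState.receive_s_of_le _ _ hs', RDState.mid_out,
    if_neg (by omega), RDState.mid_r, h1]
  -- Either the machine had found an index before `Spread` and returns 1, or it carries its new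
  -- index into the next iteration, or the loop is over and the nonempty `K` gives output 1.
  split_ifs
  · exact Or.inl ⟨rfl, by omega⟩
  · exact Or.inr ⟨rfl, hK, by omega, fun e => absurd rfl e⟩
  · exact Or.inl ⟨by simpa using hK, by omega⟩

end steps

/-! ### Failure probabilities -/

theorem card_filterMap_of_isSome {α β : Type*} (f : α → Option β) (S : Multiset α)
    (hf : ∀ a ∈ S, (f a).isSome) : (S.filterMap f).card = S.card := by
  induction S using Multiset.induction_on with
  | empty => rfl
  | cons a S ih =>
    obtain ⟨y, hy⟩ := Option.isSome_iff_exists.1 (hf a (Multiset.mem_cons_self a S))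
    rw [Multiset.filterMap_cons_some f a S hy, Multiset.card_cons, Multiset.card_cons,
      ih fun a ha => hf a (Multiset.mem_cons_of_mem ha)]

theorem card_received_le (σ : RDState k n) : σ.received.card ≤ k := by
  have h (S : Multiset (Fin k)) : (S.filterMap σ.inbox).card ≤ S.card := by
    induction S using Quotient.inductionOn with
    | h l => exact List.length_filterMap_le _ l
  exact (h _).trans_eq (by simp)

/-- The array keeps one entry per sender, so equal indices from different senders count separately.
Distinct senders in `H` therefore contribute distinct entries. -/
theorem card_le_card_received_filter {X : Fin n → Bool} (σ : RDState k n) (H : Finset (Fin k))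
    (hH : ∀ j ∈ H, ∃ x, σ.inbox j = some x ∧ X x = true) :
    H.card ≤ (σ.received.filter (· ∈ {x | X x = true})).card := by
  have h1 : H.val.filterMap σ.inbox ≤ σ.received :=
    Multiset.filterMap_le_filterMap _ (Finset.val_le_iff.2 (Finset.subset_univ H))
  have h2 := Multiset.card_le_card (Multiset.filter_le_filter (· ∈ {x | X x = true}) h1)
  rw [Multiset.filter_eq_self.2 ?_, card_filterMap_of_isSome] at h2
  · exact h2
  · intro j hj
    obtain ⟨x, hx, -⟩ := hH j hj
    simp [hx]
  · intro x hx
    obtain ⟨j, hj, hjx⟩ := (Multiset.mem_filterMap _ _).1 hx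
    obtain ⟨y, hy, hXy⟩ := hH j hj
    rw [hjx, Option.some.injEq] at hy
    exact hy ▸ hXy

section failure

variable {X : Fin n → Bool} {adv : Adversary (randomizedDisjunction k n γ pick)} {b t R r s : ℕ}
  {h : History (randomizedDisjunction k n γ pick)}

theorem card_compl_nextCorrupted_ge (hcb : h.corrupted.card ≤ b) (hb : (b : ℝ) ≤ (1 - γ) * k) :
    γ * k ≤ ((adv.nextCorrupted b h)ᶜ.card : ℝ) := by
  have h1 := card_nextCorrupted_le adv b h hcb
  have h2 : (adv.nextCorrupted b h)ᶜ.card + (adv.nextCorrupted b h).card = k := by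
    rw [Finset.card_compl_add_card, Fintype.card_fin]
  have h3 : ((adv.nextCorrupted b h)ᶜ.card : ℝ) + (adv.nextCorrupted b h).card = k := by
    exact_mod_cast h2
  have h4 : ((adv.nextCorrupted b h).card : ℝ) ≤ b := by exact_mod_cast h1
  linarith

/-- The probability that a machine obtains no verified index in a phase of `Spread`. -/
theorem toOuterMeasure_spread_miss_le (hγ : 0 < γ) (hk : 0 < k) (σ : RDState k n) (hs : σ.s ≠ 0)
    (H : Finset (Fin k)) (hH0 : 0 < H.card)
    (hH : σ.K.Nonempty ∨ ∀ j ∈ H, ∃ x, σ.inbox j = some x ∧ X x = true) :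
    (σ.sample γ).toOuterMeasure {l | (σ.mid X l).K.Nonempty}ᶜ ≤
      ENNReal.ofReal (Real.exp (-(8 * H.card * Real.log n / (γ * k)))) := by
  rcases hH with hK | hH
  · have : {l | (σ.mid X l).K.Nonempty}ᶜ = ∅ := by
      ext l; simpa using (σ.mid_K_nonempty X l hK).ne_empty
    rw [this]
    simp
  · rw [RDState.sample, if_neg hs]
    refine (MeasureTheory.measure_mono
      (t := {l : List (Fin n) | ∀ x ∈ l, x ∉ {x | X x = true}}) ?_).trans
      ((toOuterMeasure_sample_miss_le _ _ {x | X x = true} hH0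
        (card_le_card_received_filter σ H hH) (card_received_le σ)).trans ?_)
    · intro l hl x hx hX
      exact hl ⟨x, (σ.mem_mid_K X l).2 (Or.inr ⟨hx, hX⟩)⟩
    · refine ENNReal.ofReal_le_ofReal (Real.exp_le_exp.2 (neg_le_neg ?_))
      have hk' : (0 : ℝ) < k := by exact_mod_cast hk
      calc 8 * H.card * Real.log n / (γ * k) = H.card / k * (8 * Real.log n / γ) := by
            field_simp
        _ ≤ _ := by
            gcongr
            exact Nat.le_ceil _

/-- The law of the random values of the round after `h`. -/
noncomputable def History.coins (h : History (randomizedDisjunction k n γ pick)) :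
    PMF (Fin k → List (Fin n)) :=
  indep k fun i => (h.rd i).sample γ

/-- In iteration `R` some machine obtains a verified index in step 1, with high probability. -/
theorem toOuterMeasure_holders_empty_le (hγ : 0 < γ) (hk : 0 < k) (hn : 0 < n)
    (hcb : h.corrupted.card ≤ b) (hb : (b : ℝ) ≤ (1 - γ) * k)
    (hall : ∀ i ∉ h.corrupted, (h.rd i).r = R ∧ (h.rd i).s = 0)
    (hR : (n : ℝ) ≤ 2 ^ R * (Finset.univ.filter fun j => X j = true).card) :
    h.coins.toOuterMeasure {c | holders X adv b h c = ∅} ≤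
      ENNReal.ofReal (Real.exp (-Real.log n)) := by
  set A := (adv.nextCorrupted b h)ᶜ with hA
  set ones := (Finset.univ.filter fun j => X j = true) with hones
  have hn' : (0 : ℝ) < n := by exact_mod_cast hn
  have hk' : (0 : ℝ) < k := by exact_mod_cast hk
  have hones0 : 0 < ones.card := by
    rcases Nat.eq_zero_or_pos ones.card with h0 | h0
    · rw [h0] at hR
      simp at hR
      omega
    · exact h0
  refine (MeasureTheory.measure_mono
    (t := {c | ∀ i ∈ A, c i ∈ {l : List (Fin n) | ∀ x ∈ l, x ∉ {x | X x = true}}}) ?_).trans ?_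
  · intro c hc i hi x hx hX
    have : i ∈ holders X adv b h c :=
      Finset.mem_filter.2 ⟨hi, x, ((h.rd i).mem_mid_K X _).2 (Or.inr ⟨hx, hX⟩)⟩
    rw [show holders X adv b h c = ∅ from hc] at this
    simp at this
  · rw [History.coins, toOuterMeasure_indep_forall _ A
      (fun _ => {l : List (Fin n) | ∀ x ∈ l, x ∉ {x | X x = true}})]
    have hmiss : ∀ i ∈ A, ((h.rd i).sample γ).toOuterMeasure
        {l : List (Fin n) | ∀ x ∈ l, x ∉ {x | X x = true}} ≤
        ENNReal.ofReal (Real.exp (-((ones.card : ℝ) / n * mainDraws k n γ R))) := by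
      intro i hi
      obtain ⟨h1, h2⟩ := hall i
        (notMem_corrupted_of_notMem_nextCorrupted (Finset.mem_compl.1 hi))
      rw [RDState.sample, if_pos h2, h1]
      refine toOuterMeasure_sample_miss_le _ _ {x | X x = true} hones0 (le_of_eq ?_) (by simp)
      rw [hones, Finset.card_def, Finset.filter_val]
      rfl
    refine (Finset.prod_le_pow_card _ _ _ hmiss).trans ?_
    rw [← ENNReal.ofReal_pow (Real.exp_pos _).le, ← Real.exp_nat_mul]
    refine ENNReal.ofReal_le_ofReal (Real.exp_le_exp.2 ?_)
    have hAc : γ * k ≤ (A.card : ℝ) := card_compl_nextCorrupted_ge hcb hb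
    have hm : 2 ^ R * (1 / (γ * k)) * Real.log n ≤ mainDraws k n γ R := Nat.le_ceil _
    have hlog : 0 ≤ Real.log n := Real.log_natCast_nonneg n
    -- At least γk machines share the work: the factor γk cancels the one in the sample size, and
    -- the choice of R makes 2^R times the density at least 1.
    have e : Real.log n ≤ A.card * ((ones.card : ℝ) / n * mainDraws k n γ R) := by
      calc Real.log n = 1 * Real.log n := (one_mul _).symm
        _ ≤ (2 ^ R * ones.card / n) * Real.log n := by
            gcongr
            rwa [one_le_div hn']
        _ = (γ * k) * ((ones.card : ℝ) / n * (2 ^ R * (1 / (γ * k)) * Real.log n)) := by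
            field_simp
        _ ≤ _ := by gcongr
    linarith

theorem Spreading.card_pos {H : Finset (Fin k)} (hγ : 0 < γ) (hk : 0 < k)
    (hS : Spreading X R h r s H) : 0 < H.card := by
  have hk' : (0 : ℝ) < k := by exact_mod_cast hk
  have : (0 : ℝ) < H.card := lt_of_lt_of_le (by positivity) hS.2.2.2.1
  exact_mod_cast this

theorem Spreading.miss_le {H : Finset (Fin k)} (hγ : 0 < γ) (hk : 0 < k)
    (hS : Spreading X R h r s H) (i : Fin k) (hi : i ∈ (adv.nextCorrupted b h)ᶜ) :
    ((h.rd i).sample γ).toOuterMeasure {l | ((h.rd i).mid X l).K.Nonempty}ᶜ ≤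
      ENNReal.ofReal (Real.exp (-(8 * H.card * Real.log n / (γ * k)))) := by
  have hpos := hS.card_pos hγ hk
  obtain ⟨-, hs1, -, -, hall⟩ := hS
  obtain ⟨-, h2, -, h4⟩ := hall i
    (notMem_corrupted_of_notMem_nextCorrupted (Finset.mem_compl.1 hi))
  exact toOuterMeasure_spread_miss_le hγ hk _ (by omega) H hpos h4

/-- A phase of `Spread` doubles the number of senders of verified indices, up to half the number
of honest machines, with high probability. -/
theorem Spreading.toOuterMeasure_card_holders_lt {H : Finset (Fin k)} (hγ : 0 < γ) (hk : 0 < k)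
    (hn : 20 ≤ Real.log n) (hcb : h.corrupted.card ≤ b) (hb : (b : ℝ) ≤ (1 - γ) * k)
    (hS : Spreading X R h r s H) :
    h.coins.toOuterMeasure
        {c | ((holders X adv b h c).card : ℝ) < min (2 ^ s : ℝ) (γ * k / 2)} ≤
      ENNReal.ofReal (Real.exp (-(2 * Real.log n))) := by
  classical
  have hk' : (0 : ℝ) < k := by exact_mod_cast hk
  have hpos := hS.card_pos hγ hk
  have h1 := hS.2.1
  have hH := hS.2.2.2.1
  -- Either |H| ≥ 2^(s-1), and doubling gives 2^s, or |H| is already at least γk/2.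
  have hT : min (2 ^ s : ℝ) (γ * k / 2) ≤ 2 * H.card := by
    obtain ⟨u, rfl⟩ : ∃ u, s = u + 1 := ⟨s - 1, by omega⟩
    rw [Nat.add_sub_cancel] at hH
    rcases min_le_iff.1 hH with h2 | h2
    · refine (min_le_left _ _).trans ?_
      rw [pow_succ]; linarith
    · refine (min_le_right _ _).trans ?_
      linarith
  have := toOuterMeasure_indep_card_lt_of_miss (fun i => (h.rd i).sample γ)
    (adv.nextCorrupted b h)ᶜ (fun i => {l | ((h.rd i).mid X l).K.Nonempty}) hn
    (show 0 < γ * k by positivity) hpos (card_compl_nextCorrupted_ge hcb hb) hT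
    (min_le_right _ _) (x := 8 * H.card * Real.log n / (γ * k)) (by field_simp)
    (hS.miss_le hγ hk)
  refine le_trans (le_of_eq ?_) this
  simp only [History.coins, holders, Set.mem_ofPred_eq]

/-- In the last phase of `Spread` all machines obtain a verified index, with high probability. -/
theorem Spreading.toOuterMeasure_exists_empty_le {H : Finset (Fin k)} (hγ : 0 < γ) (hγ1 : γ ≤ 1)
    (hk : 0 < k) (hkn : k ≤ n) (hS : Spreading X R h r s H) (hs : s = Nat.clog 2 k) :
    h.coins.toOuterMeasure
        {c | ∃ i ∈ (adv.nextCorrupted b h)ᶜ, ¬ ((h.rd i).mid X (c i)).K.Nonempty} ≤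
      ENNReal.ofReal (Real.exp (-(2 * Real.log n))) := by
  have hk' : (0 : ℝ) < k := by exact_mod_cast hk
  have hn' : (0 : ℝ) < n := by exact_mod_cast (hk.trans_le hkn)
  have h1 := hS.2.1
  have hH := hS.2.2.2.1
  have hlog : 0 ≤ Real.log n := Real.log_natCast_nonneg n
  -- In the last phase 2^(s-1) ≥ k/2 ≥ γk/2, so the minimum is the second term. The miss exponent is
  -- then at least 4 ln n, which survives the union over k ≤ n machines.
  have hhalf : γ * k / 2 ≤ H.card := by
    refine le_trans (le_of_eq (min_eq_right ?_).symm) hH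
    obtain ⟨u, rfl⟩ : ∃ u, s = u + 1 := ⟨s - 1, by omega⟩
    have h2 : k ≤ 2 ^ (u + 1) := hs ▸ Nat.le_pow_clog (by norm_num) k
    have h3 : (k : ℝ) ≤ 2 ^ (u + 1) := by exact_mod_cast h2
    rw [Nat.add_sub_cancel]
    rw [pow_succ] at h3
    nlinarith
  refine (toOuterMeasure_indep_exists_le (fun i => (h.rd i).sample γ)
    (adv.nextCorrupted b h)ᶜ (fun i => {l | ((h.rd i).mid X l).K.Nonempty})
    (hS.miss_le hγ hk)).trans ?_
  rw [← ENNReal.ofReal_natCast, ← ENNReal.ofReal_mul hk'.le]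
  refine ENNReal.ofReal_le_ofReal ?_
  have hx : 4 * Real.log n ≤ 8 * H.card * Real.log n / (γ * k) := by
    rw [le_div_iff₀ (by positivity)]
    nlinarith
  calc (k : ℝ) * Real.exp (-(8 * H.card * Real.log n / (γ * k)))
      ≤ Real.exp (Real.log n) * Real.exp (-(4 * Real.log n)) := by
        gcongr
        rw [Real.exp_log hn']
        exact_mod_cast hkn
    _ ≤ _ := by
        rw [← Real.exp_add, Real.exp_le_exp]
        linarith

end failure

/-! ### The run of the algorithm -/

section run

variable {X : Fin n → Bool} {adv : Adversary (randomizedDisjunction k n γ pick)} {b t R : ℕ}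
  {h : History (randomizedDisjunction k n γ pick)}

theorem run_succ (t : ℕ) : run (randomizedDisjunction k n γ pick) X adv b (t + 1) =
    (run (randomizedDisjunction k n γ pick) X adv b t).bind fun h =>
      h.coins.map (h.extend X adv b) := rfl

theorem length_le_of_mem_support_coins {c : Fin k → List (Fin n)} (hc : c ∈ h.coins.support)
    (i : Fin k) : (c i).length ≤
      if (h.rd i).s = 0 then mainDraws k n γ (h.rd i).r else spreadDraws n γ := by
  have := mem_support_of_mem_support_indep hc i
  rw [RDState.sample] at this
  split_ifs at this ⊢
  · exact length_le_of_mem_support_sample this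
  · exact length_le_of_mem_support_sample this

/-- Restricting to the support supplies the sample sizes, which the query bound needs. -/
theorem accounted_of_mem_support (hk : 2 ≤ k) (hn : 2 ≤ n) :
    ∀ (t : ℕ) (h : History (randomizedDisjunction k n γ pick)),
      h ∈ (run (randomizedDisjunction k n γ pick) X adv b t).support →
      h.corrupted.card ≤ b ∧ ∀ i ∉ h.corrupted, Accounted X t h i
  | 0, h, hh => by
    rw [run, PMF.mem_support_pure_iff] at hh
    subst hh
    exact ⟨by simp [History.corrupted], fun i _ => accounted_nil X hn i⟩
  | t + 1, h', hh => by
    rw [run_succ, PMF.mem_support_bind_iff] at hh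
    obtain ⟨h, hh, hh'⟩ := hh
    rw [PMF.mem_support_map_iff] at hh'
    obtain ⟨c, hc, rfl⟩ := hh'
    obtain ⟨h1, h2⟩ := accounted_of_mem_support hk hn t h hh
    refine ⟨card_nextCorrupted_le adv b h h1, fun i hi => ?_⟩
    rw [corrupted_extend] at hi
    exact (h2 i (notMem_corrupted_of_notMem_nextCorrupted hi)).extend hk hi
      (length_le_of_mem_support_coins hc i)

/-- A bound for the probability that round `t` destroys the invariant. -/
noncomputable def stepFailure (k n R t : ℕ) : ℝ≥0∞ :=
  (if t < (R + 1) * (Nat.clog 2 k + 1) then ENNReal.ofReal (Real.exp (-(2 * Real.log n))) else 0) +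
    if t + (Nat.clog 2 k + 1) = R * (Nat.clog 2 k + 1) then
      ENNReal.ofReal (Real.exp (-Real.log n)) else 0

/-- Only two kinds of round are risky: round 0 of iteration R while still searching, and a phase of
`Spread` with good senders. All other transitions preserve the invariant surely. -/
theorem toOuterMeasure_not_progress_le (hk : 2 ≤ k) (hkn : k ≤ n) (hγ : 0 < γ) (hγ1 : γ ≤ 1)
    (hn : 20 ≤ Real.log n) (hb : (b : ℝ) ≤ (1 - γ) * k)
    (hpick : ∀ i r s K, K.Nonempty → pick i r s K ∈ K) (hRN : R ≤ Nat.clog 2 n)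
    (hR : (n : ℝ) ≤ 2 ^ R * (Finset.univ.filter fun j => X j = true).card)
    (hcb : h.corrupted.card ≤ b) (hacc : ∀ i ∉ h.corrupted, Accounted X t h i)
    (hP : Progress X R h) :
    h.coins.toOuterMeasure {c | ¬ Progress X R (h.extend X adv b c)} ≤ stepFailure k n R t := by
  have hL : 0 < Nat.clog 2 k := Nat.clog_pos (by norm_num) hk
  have hk0 : 0 < k := by omega
  -- Some uncorrupted machine exists because γk > 0; its clock translates the common `r` and `s`
  -- into the time `t`.
  obtain ⟨i, hi⟩ : ∃ i, i ∉ h.corrupted := by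
    have h1 := card_compl_nextCorrupted_ge (adv := adv) hcb hb
    have h2 : (0 : ℝ) < (adv.nextCorrupted b h)ᶜ.card :=
      lt_of_lt_of_le (mul_pos hγ (by exact_mod_cast hk0)) h1
    obtain ⟨i, hi⟩ := Finset.card_pos.1 (show 0 < (adv.nextCorrupted b h)ᶜ.card by exact_mod_cast h2)
    exact ⟨i, notMem_corrupted_of_notMem_nextCorrupted (Finset.mem_compl.1 hi)⟩
  have hzero (hs : ∀ c, Progress X R (h.extend X adv b c)) :
      h.coins.toOuterMeasure {c | ¬ Progress X R (h.extend X adv b c)} ≤ stepFailure k n R t := by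
    simp [hs]
  rcases hP with ⟨r, s, hS⟩ | ⟨r, s, H, hS⟩ | hI
  · obtain ⟨hrR, hr0, hall⟩ := id hS
    have hinf (h0 : s = 0) (c : Fin k → List (Fin n)) (hne : holders X adv b h c ≠ ∅) :
        Progress X R (h.extend X adv b c) := by
      refine Or.inr (Or.inl ⟨r, s + 1, _, spreading_extend hpick hacc hrR (by omega)
        (fun i hi => ⟨(hall i hi).1, (hall i hi).2.1, (hall i hi).2.2.1⟩) ?_⟩)
      refine (min_le_left _ _).trans ?_
      rw [h0, pow_zero]
      exact_mod_cast Finset.card_pos.2 (Finset.nonempty_iff_ne_empty.2 hne)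
    by_cases h0 : s = 0
    · by_cases hrR' : r = R
      · have htime := (hacc i hi).time (hall i hi).2.2.1
        rw [(hall i hi).1, (hall i hi).2.1, h0, hrR', add_zero] at htime
        have hle := toOuterMeasure_holders_empty_le (adv := adv) hγ hk0 (by omega) hcb hb
          (fun i hi => ⟨hrR' ▸ (hall i hi).1, h0 ▸ (hall i hi).2.1⟩) hR
        rw [stepFailure, if_pos htime]
        refine (MeasureTheory.measure_mono fun c hc => ?_).trans (hle.trans le_add_self)
        by_contra hne
        exact hc (hinf h0 c hne)
      · refine hzero fun c => ?_
        by_cases hne : holders X adv b h c = ∅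
        · exact Or.inl (hS.extend hRN fun _ => ⟨hrR', hne⟩)
        · exact hinf h0 c hne
    · exact hzero fun c => Or.inl (hS.extend hRN fun e => absurd e h0)
  · obtain ⟨hrR, hs1, hsL, -, hall⟩ := id hS
    have htime := (hacc i hi).time (hall i hi).2.2.1
    rw [(hall i hi).1, (hall i hi).2.1] at htime
    have hmul := Nat.mul_le_mul_right (Nat.clog 2 k + 1) hrR
    have htlt : t < (R + 1) * (Nat.clog 2 k + 1) := by
      rw [add_mul, one_mul]; omega
    rw [stepFailure, if_pos htlt]
    rcases hsL.lt_or_eq with hs | hs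
    · refine (MeasureTheory.measure_mono fun c hc => ?_).trans
        ((hS.toOuterMeasure_card_holders_lt (adv := adv) hγ hk0 hn hcb hb).trans le_self_add)
      rw [Set.mem_ofPred_eq]
      by_contra hge
      exact hc (Or.inr (Or.inl ⟨r, s + 1, _, spreading_extend hpick hacc hrR hs
        (fun i hi => ⟨(hall i hi).1, (hall i hi).2.1, (hall i hi).2.2.1⟩) (not_lt.1 hge)⟩))
    · refine (MeasureTheory.measure_mono fun c hc => ?_).trans
        ((hS.toOuterMeasure_exists_empty_le (adv := adv) (b := b) hγ hγ1 hk0 hkn hs).trans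
          le_self_add)
      rw [Set.mem_ofPred_eq]
      by_contra hex
      push Not at hex
      exact hc (Or.inr (Or.inr (hS.informed_extend hs fun i hi => hex i (Finset.mem_compl.2 hi))))
  · exact hzero fun c => Or.inr (Or.inr hI.extend)

theorem toOuterMeasure_run_not_progress_le (hk : 2 ≤ k) (hkn : k ≤ n) (hγ : 0 < γ) (hγ1 : γ ≤ 1)
    (hn : 20 ≤ Real.log n) (hb : (b : ℝ) ≤ (1 - γ) * k)
    (hpick : ∀ i r s K, K.Nonempty → pick i r s K ∈ K) (hR1 : 1 ≤ R) (hRN : R ≤ Nat.clog 2 n)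
    (hR : (n : ℝ) ≤ 2 ^ R * (Finset.univ.filter fun j => X j = true).card) :
    ∀ t, (run (randomizedDisjunction k n γ pick) X adv b t).toOuterMeasure
      {h | Progress X R h}ᶜ ≤ ∑ u ∈ Finset.range t, stepFailure k n R u
  | 0 => by
    have : Progress X R ([] : History (randomizedDisjunction k n γ pick)) :=
      Or.inl ⟨1, 0, hR1, fun _ => rfl, fun i _ => ⟨rfl, rfl, rfl, fun e => absurd rfl e⟩⟩
    rw [run, toOuterMeasure_eq_expect, expect_pure]
    simp [this]
  | t + 1 => by
    rw [Finset.sum_range_succ, run_succ]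
    refine (toOuterMeasure_bind_compl_le (s := {h | Progress X R h}) fun h hh hP => ?_).trans
      (add_le_add_left (toOuterMeasure_run_not_progress_le hk hkn hγ hγ1 hn hb hpick hR1 hRN hR t) _)
    obtain ⟨h1, h2⟩ := accounted_of_mem_support hk (hk.trans hkn) t h hh
    rw [PMF.toOuterMeasure_map_apply]
    exact toOuterMeasure_not_progress_le hk hkn hγ hγ1 hn hb hpick hRN hR h1 h2 hP

/-- The bound is free of `t`: spreading failures are charged only before a fixed time, and the
search failure in at most one round. -/
theorem sum_stepFailure_le (k n R t : ℕ) :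
    ∑ u ∈ Finset.range t, stepFailure k n R u ≤
      ENNReal.ofReal (((R + 1) * (Nat.clog 2 k + 1) : ℕ) * Real.exp (-(2 * Real.log n)) +
        Real.exp (-Real.log n)) := by
  simp only [stepFailure]
  rw [Finset.sum_add_distrib, ENNReal.ofReal_add (by positivity) (by positivity)]
  refine add_le_add ?_ ?_
  · rw [← Finset.sum_filter, Finset.sum_const, nsmul_eq_mul, ENNReal.ofReal_mul (by positivity),
      ENNReal.ofReal_natCast]
    gcongr
    calc _ ≤ (Finset.range ((R + 1) * (Nat.clog 2 k + 1))).card :=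
          Finset.card_le_card fun u hu => by
            simp only [Finset.mem_filter, Finset.mem_range] at hu ⊢
            exact hu.2
      _ = _ := Finset.card_range _
  · rw [← Finset.sum_filter, Finset.sum_const, nsmul_eq_mul]
    refine mul_le_of_le_one_left' ?_
    have : ((Finset.range t).filter fun u =>
        u + (Nat.clog 2 k + 1) = R * (Nat.clog 2 k + 1)).card ≤ 1 := by
      rw [Finset.card_le_one]
      intro a ha b hb
      simp only [Finset.mem_filter] at ha hb
      omega
    exact_mod_cast this

end run

/-! ### Numerical bounds -/

theorem succ_sq_le_four_mul_two_pow (N : ℕ) : (N + 1) ^ 2 ≤ 4 * 2 ^ N := by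
  induction N with
  | zero => norm_num
  | succ N ih =>
    rcases Nat.lt_or_ge N 2 with h | h
    · interval_cases N <;> norm_num
    · rw [pow_succ 2 N]
      nlinarith

theorem two_pow_clog_le (hn : 2 ≤ n) : 2 ^ Nat.clog 2 n ≤ 2 * n := by
  have h1 := Nat.pow_pred_clog_lt_self (b := 2) (by norm_num) (x := n) (by omega)
  have h2 : 0 < Nat.clog 2 n := Nat.clog_pos (by norm_num) hn
  obtain ⟨u, hu⟩ : ∃ u, Nat.clog 2 n = u + 1 := ⟨_, (Nat.succ_pred_eq_of_pos h2).symm⟩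
  rw [hu] at h1 ⊢
  rw [pow_succ]
  simp at h1
  omega

/-- The number of risky rounds is at most (⌈log₂ n⌉ + 1)^2 ≤ 8n. At n^(-2) each they contribute 8/n,
and the search contributes 1/n. -/
theorem failure_le (hk : 2 ≤ k) (hkn : k ≤ n) {R : ℕ} (hR : R ≤ Nat.clog 2 n) :
    ((R + 1) * (Nat.clog 2 k + 1) : ℕ) * Real.exp (-(2 * Real.log n)) + Real.exp (-Real.log n) ≤
      9 / n := by
  have hn : (0 : ℝ) < n := by exact_mod_cast (show 0 < n by omega)
  have h1 : (R + 1) * (Nat.clog 2 k + 1) ≤ 8 * n := by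
    calc (R + 1) * (Nat.clog 2 k + 1) ≤ (Nat.clog 2 n + 1) * (Nat.clog 2 n + 1) := by
          gcongr
      _ ≤ 4 * 2 ^ Nat.clog 2 n := by
          rw [← sq]; exact succ_sq_le_four_mul_two_pow _
      _ ≤ 8 * n := by have := two_pow_clog_le (n := n) (by omega); omega
  have h2 : (((R + 1) * (Nat.clog 2 k + 1) : ℕ) : ℝ) ≤ 8 * n := by exact_mod_cast h1
  have e1 : Real.exp (-Real.log n) = 1 / n := by
    rw [Real.exp_neg, Real.exp_log hn, one_div]
  have e2 : Real.exp (-(2 * Real.log n)) = 1 / n * (1 / n) := by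
    rw [two_mul, neg_add, Real.exp_add, e1]
  rw [e1, e2]
  calc _ ≤ 8 * n * (1 / n * (1 / n)) + 1 / (n : ℝ) := by gcongr
    _ = 9 / n := by field_simp; norm_num

section numeric

variable {d : ℝ} {R r s : ℕ}

theorem one_le_logb_two_natCast (hk : 2 ≤ k) : 1 ≤ Real.logb 2 k := by
  rw [Real.le_logb_iff_rpow_le (by norm_num) (by positivity), Real.rpow_one]
  exact_mod_cast hk

theorem one_le_logb_two_div (hd : 0 < d) (hd1 : d ≤ 1) : 1 ≤ Real.logb 2 (2 / d) := by
  rw [Real.le_logb_iff_rpow_le (by norm_num) (by positivity), Real.rpow_one, le_div_iff₀ hd]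
  linarith

theorem le_two_mul_logb (hd : 0 < d) (hd1 : d ≤ 1) (hR : (2 : ℝ) ^ R ≤ 4 / d) :
    (R : ℝ) ≤ 2 * Real.logb 2 (2 / d) := by
  have h1 := one_le_logb_two_div hd hd1
  have h2 : (R : ℝ) ≤ Real.logb 2 (4 / d) := by
    rwa [Real.le_logb_iff_rpow_le (by norm_num) (by positivity), Real.rpow_natCast]
  have h3 : Real.logb 2 (4 / d) = 1 + Real.logb 2 (2 / d) := by
    rw [show 4 / d = 2 * (2 / d) by ring, Real.logb_mul (by norm_num) (by positivity),
      Real.logb_self_eq_one (by norm_num)]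
  linarith

theorem clog_succ_le_three_mul_logb (hk : 2 ≤ k) :
    ((Nat.clog 2 k + 1 : ℕ) : ℝ) ≤ 3 * Real.logb 2 k := by
  have h1 := one_le_logb_two_natCast hk
  have h2 : (2 : ℝ) ^ Nat.clog 2 k ≤ 2 * k := by exact_mod_cast two_pow_clog_le hk
  have hk' : (0 : ℝ) < k := by exact_mod_cast (show 0 < k by omega)
  have h3 : (Nat.clog 2 k : ℝ) ≤ Real.logb 2 (2 * k) := by
    rwa [Real.le_logb_iff_rpow_le (by norm_num) (by positivity), Real.rpow_natCast]
  rw [Real.logb_mul (by norm_num) hk'.ne', Real.logb_self_eq_one (by norm_num)] at h3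
  push_cast
  linarith

/-- The constant is 4 · 3: R + 2 is at most 4 log₂(2/d), and an iteration has at most 3 log₂ k
rounds. -/
theorem rounds_le (hk : 2 ≤ k) (hd : 0 < d) (hd1 : d ≤ 1) (hR : (2 : ℝ) ^ R ≤ 4 / d)
    (hr : r ≤ R + 1) (hs : s ≤ Nat.clog 2 k) :
    ((r * (Nat.clog 2 k + 1) + s : ℕ) : ℝ) ≤ 12 * (Real.logb 2 k * Real.logb 2 (2 / d)) := by
  have h1 := one_le_logb_two_div hd hd1
  have h2 := le_two_mul_logb hd hd1 hR
  have h3 := clog_succ_le_three_mul_logb hk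
  have h4 : r * (Nat.clog 2 k + 1) + s ≤ (R + 2) * (Nat.clog 2 k + 1) := by
    have := Nat.mul_le_mul_right (Nat.clog 2 k + 1) hr
    rw [show R + 2 = (R + 1) + 1 by rfl, add_mul (R + 1) 1]
    omega
  calc ((r * (Nat.clog 2 k + 1) + s : ℕ) : ℝ) ≤ ((R + 2) * (Nat.clog 2 k + 1) : ℕ) := by
        exact_mod_cast h4
    _ = (R + 2 : ℝ) * (Nat.clog 2 k + 1 : ℕ) := by push_cast; ring
    _ ≤ (4 * Real.logb 2 (2 / d)) * (3 * Real.logb 2 k) := by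
        gcongr
        linarith
    _ = _ := by ring

theorem log_le_logb_two (n : ℕ) : Real.log n ≤ Real.logb 2 n := by
  rw [← Real.log_div_log, le_div_iff₀ (Real.log_pos (by norm_num))]
  have := Real.log_two_lt_d9
  have h : 0 ≤ Real.log n := Real.log_natCast_nonneg n
  nlinarith

theorem sum_mainDraws_le (hγ : 0 < γ) (hk : 0 < k) (N : ℕ) :
    ((∑ q ∈ Finset.range N, mainDraws k n γ q : ℕ) : ℝ) ≤
      2 ^ N * (Real.log n / (γ * k)) + N := by
  have hk' : (0 : ℝ) < k := by exact_mod_cast hk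
  have hlog : 0 ≤ Real.log n := Real.log_natCast_nonneg n
  have h0 : 0 ≤ Real.log n / (γ * k) := by positivity
  induction N with
  | zero => simpa using h0
  | succ N ih =>
    rw [Finset.sum_range_succ, pow_succ]
    have h1 : (mainDraws k n γ N : ℝ) < 2 ^ N * (1 / (γ * k)) * Real.log n + 1 :=
      Nat.ceil_lt_add_one (by positivity)
    have h2 : 2 ^ N * (1 / (γ * k)) * Real.log n = 2 ^ N * (Real.log n / (γ * k)) := by ring
    push_cast at ih ⊢
    linarith

/-- The main draws form a geometric sum dominated by the last iteration. Their ceilings cost at most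
one per iteration, 4ℓ in all, which the second term absorbs; hence 112 = 108 + 4. -/
theorem queryBudget_le (hγ : 0 < γ) (hγ1 : γ ≤ 1) (hk : 2 ≤ k) (hn : 2 ≤ n) (hd : 0 < d)
    (hd1 : d ≤ 1) (hR : (2 : ℝ) ^ R ≤ 4 / d) (hr : r ≤ R + 1) (hr1 : 1 ≤ r)
    (hs : s ≤ Nat.clog 2 k) :
    (queryBudget k n γ r s : ℝ) ≤ 112 * (Real.logb 2 n / (γ * k * d) +
      Real.logb 2 k * Real.logb 2 n * Real.logb 2 (2 / d) / γ) := by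
  have hk' : (0 : ℝ) < k := by exact_mod_cast (show 0 < k by omega)
  have hℓ := one_le_logb_two_div hd hd1
  have hκ := one_le_logb_two_natCast hk
  have hν := one_le_logb_two_natCast hn
  have hlog := log_le_logb_two n
  have hlog0 : 0 ≤ Real.log n := Real.log_natCast_nonneg n
  have hR2 := le_two_mul_logb hd hd1 hR
  have hrounds := rounds_le hk hd hd1 hR hr hs
  set ℓ := Real.logb 2 (2 / d)
  set κ := Real.logb 2 k
  set ν := Real.logb 2 n
  have hM : (spreadDraws n γ : ℝ) ≤ 9 * ν / γ := by
    have h1 : (spreadDraws n γ : ℝ) < 8 * Real.log n / γ + 1 :=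
      Nat.ceil_lt_add_one (by positivity)
    have h2 : 8 * Real.log n / γ + 1 ≤ 9 * ν / γ := by
      rw [div_add_one hγ.ne', div_le_div_iff_of_pos_right hγ]
      linarith
    linarith
  have hmain : ∑ q ∈ Finset.Ico 1 r, mainDraws k n γ q +
      (if s = 0 then 0 else mainDraws k n γ r) ≤ ∑ q ∈ Finset.range (R + 2), mainDraws k n γ q := by
    calc _ ≤ ∑ q ∈ Finset.Ico 1 (r + 1), mainDraws k n γ q := by
          rw [Finset.sum_Ico_succ_top hr1]
          split_ifs <;> omega
      _ ≤ _ := Finset.sum_le_sum_of_subset fun q hq => by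
          simp only [Finset.mem_Ico, Finset.mem_range] at hq ⊢
          omega
  have hmain' : ((∑ q ∈ Finset.Ico 1 r, mainDraws k n γ q +
      (if s = 0 then 0 else mainDraws k n γ r) : ℕ) : ℝ) ≤ 16 * (ν / (γ * k * d)) + 4 * ℓ := by
    refine (Nat.cast_le.2 hmain).trans ((sum_mainDraws_le hγ (by omega) _).trans ?_)
    have h1 : (2 : ℝ) ^ (R + 2) * (Real.log n / (γ * k)) ≤ 16 * (ν / (γ * k * d)) := by
      calc (2 : ℝ) ^ (R + 2) * (Real.log n / (γ * k)) = 4 * 2 ^ R * (Real.log n / (γ * k)) := by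
            ring
        _ ≤ 4 * (4 / d) * (ν / (γ * k)) := by gcongr
        _ = _ := by field_simp; norm_num
    push_cast
    linarith
  have hsec : ℓ ≤ κ * ν * ℓ / γ := by
    calc ℓ ≤ κ * ν * ℓ := by
          have : 1 ≤ κ * ν := one_le_mul_of_one_le_of_one_le hκ hν
          nlinarith
      _ ≤ κ * ν * ℓ / γ := by
          rw [le_div_iff₀ hγ]
          have : 0 ≤ κ * ν * ℓ := by positivity
          nlinarith
  have hspread : ((r * (Nat.clog 2 k + 1) + s : ℕ) : ℝ) * spreadDraws n γ ≤
      108 * (κ * ν * ℓ / γ) := by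
    calc _ ≤ 12 * (κ * ℓ) * (9 * ν / γ) := by gcongr
      _ = _ := by ring
  have hfirst : 0 ≤ ν / (γ * k * d) := by positivity
  unfold queryBudget
  rw [Nat.cast_add, Nat.cast_mul]
  linarith

end numeric

/-! ### The density of ones and the decisive iteration -/

theorem modifiedDensity_pos (X : Fin n → Bool) (hn : 0 < n) : 0 < modifiedDensity X :=
  lt_of_lt_of_le (by positivity) (le_max_left _ _)

theorem modifiedDensity_le_one (X : Fin n → Bool) (hn : 0 < n) : modifiedDensity X ≤ 1 := by
  have hn' : (0 : ℝ) < n := by exact_mod_cast hn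
  refine max_le ?_ ?_
  · rw [div_le_one hn']
    exact_mod_cast hn
  · rw [div_le_one hn']
    exact_mod_cast (Finset.card_le_univ _).trans_eq (Fintype.card_fin n)

theorem modifiedDensity_of_exists (X : Fin n → Bool) (hX : ∃ j, X j = true) :
    modifiedDensity X = ((Finset.univ.filter fun j => X j = true).card : ℝ) / n := by
  refine max_eq_right ?_
  obtain ⟨j, hj⟩ := hX
  gcongr
  exact_mod_cast Finset.card_pos.2 ⟨j, by simpa using hj⟩

theorem modifiedDensity_of_not_exists (X : Fin n → Bool) (hX : ¬ ∃ j, X j = true) :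
    modifiedDensity X = 1 / n := by
  push Not at hX
  rw [modifiedDensity, Finset.filter_false_of_mem fun j _ => hX j]
  simp

/-- The iteration in which some machine finds a one in step 1, with high probability. -/
theorem exists_iteration (X : Fin n → Bool) (hX : ∃ j, X j = true) (hn : 2 ≤ n) :
    ∃ R, 1 ≤ R ∧ R ≤ Nat.clog 2 n ∧
      n ≤ 2 ^ R * (Finset.univ.filter fun j => X j = true).card ∧
      2 ^ R * (Finset.univ.filter fun j => X j = true).card ≤ 2 * n := by
  set m := (Finset.univ.filter fun j => X j = true).card with hm
  have hm0 : 0 < m := by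
    obtain ⟨j, hj⟩ := hX
    exact Finset.card_pos.2 ⟨j, by simpa using hj⟩
  have hmn : m ≤ n := (Finset.card_le_univ _).trans_eq (Fintype.card_fin n)
  have hN : 1 ≤ Nat.clog 2 n ∧ n ≤ 2 ^ Nat.clog 2 n * m :=
    ⟨Nat.clog_pos (by norm_num) hn,
      (Nat.le_pow_clog (by norm_num) n).trans (Nat.le_mul_of_pos_right _ hm0)⟩
  classical
  -- The loop starts at 1, so the minimum is taken over R ≥ 1; when it equals 1, the upper bound
  -- comes from m ≤ n instead of minimality.
  have hex : ∃ R, 1 ≤ R ∧ n ≤ 2 ^ R * m := ⟨_, hN⟩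
  obtain ⟨h1, h2⟩ := Nat.find_spec hex
  refine ⟨Nat.find hex, h1, Nat.find_min' hex hN, h2, ?_⟩
  obtain ⟨u, hu⟩ : ∃ u, Nat.find hex = u + 1 := ⟨Nat.find hex - 1, by omega⟩
  have hmin := Nat.find_min hex (m := u) (by omega)
  rw [hu]
  rcases Nat.eq_zero_or_pos u with rfl | hu0
  · simpa using hmn
  · have : 2 ^ u * m < n := by
      by_contra hge
      exact hmin ⟨hu0, not_lt.1 hge⟩
    rw [pow_succ]
    linarith

/-! ### The theorem -/

/-- The histories in which the problem is solved within the claimed complexity bounds. -/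
def Success (C β : ℝ) (X : Fin n → Bool) :
    Set (History (randomizedDisjunction k n (1 - β) pick)) :=
  {h | SolvesDisjunction X h ∧
    (∀ i ∉ h.corrupted, (h.queries i : ℝ) ≤
      C * (Real.logb 2 n / ((1 - β) * k * modifiedDensity X) +
        Real.logb 2 k * Real.logb 2 n * Real.logb 2 (2 / modifiedDensity X) / (1 - β))) ∧
    (h.messages : ℝ) ≤ C * ((k : ℝ) ^ 2 * Real.logb 2 k * Real.logb 2 (2 / modifiedDensity X))}

theorem mem_success {β C : ℝ} {X : Fin n → Bool} {R t : ℕ}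
    {h : History (randomizedDisjunction k n (1 - β) pick)} (hk : 2 ≤ k) (hn : 2 ≤ n) (hβ : 0 ≤ β)
    (hβ1 : β < 1) (hC : 112 ≤ C) (hR : (2 : ℝ) ^ R ≤ 4 / modifiedDensity X)
    (hacc : ∀ i ∉ h.corrupted, Accounted X t h i)
    (hr : ∀ i ∉ h.corrupted, (h.rd i).r ≤ R + 1)
    (hout : ∀ i ∉ h.corrupted, (h.rd i).out = some (decide (∃ j, X j = true))) :
    h ∈ Success C β X := by
  have hd := modifiedDensity_pos X (by omega)
  have hd1 := modifiedDensity_le_one X (by omega)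
  have hℓ := one_le_logb_two_div hd hd1
  have hκ := one_le_logb_two_natCast hk
  have hν := one_le_logb_two_natCast hn
  have hγ : 0 < 1 - β := by linarith
  refine ⟨hout, fun i hi => ?_, ?_⟩
  · have ha := hacc i hi
    refine (Nat.cast_le.2 ha.queries).trans ((queryBudget_le hγ (by linarith) hk hn hd hd1 hR
      (hr i hi) ha.one_le_r ha.s_le).trans ?_)
    gcongr
  · rw [History.messages_eq_sum_sent]
    have h1 (i : Fin k) (hi : i ∈ (History.corrupted h)ᶜ) : (h.sent i : ℝ) ≤
        k * (12 * (Real.logb 2 k * Real.logb 2 (2 / modifiedDensity X))) := by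
      have hi' := Finset.mem_compl.1 hi
      refine (Nat.cast_le.2 (hacc i hi').sent).trans ?_
      rw [Nat.cast_mul]
      gcongr
      exact rounds_le hk hd hd1 hR (hr i hi') (hacc i hi').s_le
    rw [Nat.cast_sum]
    refine (Finset.sum_le_card_nsmul _ _ _ h1).trans ?_
    rw [nsmul_eq_mul]
    have h2 : ((History.corrupted h)ᶜ.card : ℝ) ≤ k := by
      exact_mod_cast (Finset.card_le_univ _).trans_eq (Fintype.card_fin k)
    calc _ ≤ (k : ℝ) * (k * (12 * (Real.logb 2 k * Real.logb 2 (2 / modifiedDensity X)))) := by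
          gcongr
      _ = 12 * ((k : ℝ) ^ 2 * Real.logb 2 k * Real.logb 2 (2 / modifiedDensity X)) := by ring
      _ ≤ _ := by
          gcongr
          linarith

theorem le_of_logb_le {X : Fin n → Bool} {C : ℝ} {R t : ℕ} (hk : 2 ≤ k) (hn : 0 < n)
    (hC : 12 ≤ C) (hR : (2 : ℝ) ^ R ≤ 4 / modifiedDensity X)
    (ht : C * (Real.logb 2 k * Real.logb 2 (2 / modifiedDensity X)) ≤ t) :
    R * (Nat.clog 2 k + 1) ≤ t := by
  have hd := modifiedDensity_pos X hn
  have hd1 := modifiedDensity_le_one X hn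
  have hℓ := one_le_logb_two_div hd hd1
  have hκ := one_le_logb_two_natCast hk
  have h1 := rounds_le hk hd hd1 hR (Nat.le_succ R) (Nat.zero_le _)
  have h2 : 12 * (Real.logb 2 k * Real.logb 2 (2 / modifiedDensity X)) ≤
      C * (Real.logb 2 k * Real.logb 2 (2 / modifiedDensity X)) := by gcongr
  exact_mod_cast h1.trans (h2.trans ht)

/-- On an input without ones the algorithm succeeds with certainty. -/
theorem mem_success_of_not_exists {β C : ℝ} {X : Fin n → Bool} {t : ℕ}
    {h : History (randomizedDisjunction k n (1 - β) pick)} (hk : 2 ≤ k) (hn : 2 ≤ n) (hβ : 0 ≤ β)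
    (hβ1 : β < 1) (hC : 112 ≤ C) (hX : ¬ ∃ j, X j = true)
    (hacc : ∀ i ∉ h.corrupted, Accounted X t h i)
    (ht : C * (Real.logb 2 k * Real.logb 2 (2 / modifiedDensity X)) ≤ t) :
    h ∈ Success C β X := by
  have hn' : (0 : ℝ) < n := by exact_mod_cast (show 0 < n by omega)
  have hR : (2 : ℝ) ^ Nat.clog 2 n ≤ 4 / modifiedDensity X := by
    rw [modifiedDensity_of_not_exists X hX]
    have : (2 : ℝ) ^ Nat.clog 2 n ≤ 2 * n := by exact_mod_cast two_pow_clog_le hn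
    calc (2 : ℝ) ^ Nat.clog 2 n ≤ 2 * n := this
      _ ≤ 4 * n := by linarith
      _ = _ := by field_simp
  have ht' := le_of_logb_le hk (by omega) (by linarith) hR ht
  refine mem_success hk hn hβ hβ1 hC hR hacc (fun i hi => (hacc i hi).r_le) fun i hi => ?_
  have ha := hacc i hi
  rw [decide_eq_false hX]
  -- Still running contradicts the clock, and output 1 would require a verified index, hence a one
  -- in the input.
  rcases hout : (h.rd i).out with _ | _ | _
  · have h1 := ha.time hout
    have h2 := Nat.mul_le_mul_right (Nat.clog 2 k + 1) (ha.r_le_of_none hout)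
    have := ha.s_le
    omega
  · rfl
  · obtain ⟨x, hx⟩ := ha.out_true hout
    exact absurd ⟨x, ha.verified x hx⟩ hX

/-- After R + 1 iterations no uncorrupted machine can still be running, which leaves only the first
alternative of `Informed`. The cost bounds are applied with R + 1 as last iteration, as informed
machines may need one extra. -/
theorem Progress.mem_success {β C : ℝ} {X : Fin n → Bool} {R t : ℕ}
    {h : History (randomizedDisjunction k n (1 - β) pick)} (hk : 2 ≤ k) (hn : 2 ≤ n) (hβ : 0 ≤ β)
    (hβ1 : β < 1) (hC : 112 ≤ C) (hX : ∃ j, X j = true)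
    (hR : (2 : ℝ) ^ (R + 1) ≤ 4 / modifiedDensity X)
    (hacc : ∀ i ∉ h.corrupted, Accounted X t h i)
    (ht : C * (Real.logb 2 k * Real.logb 2 (2 / modifiedDensity X)) ≤ t)
    (hP : Progress X R h) : h ∈ Success C β X := by
  have ht' := le_of_logb_le hk (by omega) (by linarith) hR ht
  have hdone (i : Fin k) (hi : i ∉ h.corrupted) (hr : (h.rd i).r ≤ R + 1) :
      (h.rd i).out ≠ none := by
    intro hout
    have h1 := (hacc i hi).time hout
    have h2 := Nat.mul_le_mul_right (Nat.clog 2 k + 1) hr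
    have := (hacc i hi).s_le
    omega
  have key (i : Fin k) (hi : i ∉ h.corrupted) :
      (h.rd i).out = some true ∧ (h.rd i).r ≤ R + 2 := by
    rcases hP with ⟨r, s, hr, -, hall⟩ | ⟨r, s, H, hr, -, -, -, hall⟩ | hI
    · obtain ⟨h1, -, h3, -⟩ := hall i hi
      exact absurd h3 (hdone i hi (by omega))
    · obtain ⟨h1, -, h3, -⟩ := hall i hi
      exact absurd h3 (hdone i hi (by omega))
    · rcases hI i hi with h1 | ⟨h1, -, h3, -⟩
      · exact h1
      · exact absurd h1 (hdone i hi h3)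
  refine CCA.mem_success hk hn hβ hβ1 hC hR hacc (fun i hi => (key i hi).2) fun i hi => ?_
  rw [decide_eq_true hX]
  exact (key i hi).1

theorem twenty_le_log (hn : (10 : ℝ) ^ 9 ≤ n) : 20 ≤ Real.log n := by
  rw [Real.le_log_iff_exp_le (by linarith)]
  refine le_trans ?_ hn
  have h1 := Real.exp_one_lt_d9
  rw [show (20 : ℝ) = (20 : ℕ) * 1 by norm_num, Real.exp_nat_mul]
  calc Real.exp 1 ^ 20 ≤ 2.72 ^ 20 := pow_le_pow_left₀ (Real.exp_pos _).le (by linarith) 20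
    _ ≤ 10 ^ 9 := by norm_num

theorem le_toOuterMeasure_success {β : ℝ} (hk : 2 ≤ k) (hkn : k ≤ n) (hβ : 0 ≤ β) (hβ1 : β < 1)
    (hpick : ∀ i r s K, K.Nonempty → pick i r s K ∈ K) (X : Fin n → Bool)
    (adv : Adversary (randomizedDisjunction k n (1 - β) pick)) (t : ℕ)
    (ht : 10 ^ 9 * (Real.logb 2 k * Real.logb 2 (2 / modifiedDensity X)) ≤ (t : ℝ)) :
    ENNReal.ofReal (1 - 10 ^ 9 / n) ≤
      (run (randomizedDisjunction k n (1 - β) pick) X adv ⌊β * k⌋₊ t).toOuterMeasure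
        (Success (10 ^ 9) β X) := by
  have hn : 2 ≤ n := hk.trans hkn
  have hn' : (0 : ℝ) < n := by exact_mod_cast (show 0 < n by omega)
  set p := run (randomizedDisjunction k n (1 - β) pick) X adv ⌊β * k⌋₊ t with hp
  have hsupp := accounted_of_mem_support (X := X) (adv := adv) (b := ⌊β * k⌋₊) hk hn t
  have of_compl (a : ℝ) (ha0 : 0 ≤ a) (ha : a ≤ 10 ^ 9 / n)
      (s : Set (History (randomizedDisjunction k n (1 - β) pick)))
      (hs : p.toOuterMeasure sᶜ ≤ ENNReal.ofReal a)
      (hsub : ∀ h ∈ p.support, h ∈ s → h ∈ Success (10 ^ 9) β X) :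
      ENNReal.ofReal (1 - 10 ^ 9 / n) ≤ p.toOuterMeasure (Success (10 ^ 9) β X) := by
    have h1 : p.toOuterMeasure s ≤ p.toOuterMeasure (Success (10 ^ 9) β X) :=
      PMF.toOuterMeasure_mono p fun h hh => hsub h hh.2 hh.1
    refine le_trans ?_ h1
    calc ENNReal.ofReal (1 - 10 ^ 9 / n) ≤ ENNReal.ofReal (1 - a) :=
          ENNReal.ofReal_le_ofReal (by linarith)
      _ = 1 - ENNReal.ofReal a := by rw [ENNReal.ofReal_sub _ ha0, ENNReal.ofReal_one]
      _ ≤ 1 - p.toOuterMeasure sᶜ := tsub_le_tsub_left hs _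
      _ ≤ p.toOuterMeasure s := by
          rw [tsub_le_iff_right, toOuterMeasure_add_compl]
  by_cases hX : ∃ j, X j = true
  -- Below 10^9 the claimed probability is not positive. From there on ln n ≥ 20, as the Chernoff
  -- bound requires.
  · rcases lt_or_ge (n : ℝ) (10 ^ 9) with hsmall | hlarge
    · rw [ENNReal.ofReal_of_nonpos]
      · exact zero_le
      · rw [sub_nonpos, one_le_div hn']
        exact hsmall.le
    · obtain ⟨R, hR1, hRN, hR, hR'⟩ := exists_iteration X hX hn
      set m := (Finset.univ.filter fun j => X j = true).card with hm
      have hm0 : (0 : ℝ) < m := by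
        obtain ⟨j, hj⟩ := hX
        exact_mod_cast Finset.card_pos.2 ⟨j, by simpa using hj⟩
      have hRd : (2 : ℝ) ^ (R + 1) ≤ 4 / modifiedDensity X := by
        rw [modifiedDensity_of_exists X hX, div_div_eq_mul_div, le_div_iff₀ hm0, pow_succ]
        have : (2 : ℝ) ^ R * m ≤ 2 * n := by exact_mod_cast hR'
        linarith
      have hb : ((⌊β * k⌋₊ : ℕ) : ℝ) ≤ (1 - (1 - β)) * k := by
        rw [sub_sub_cancel]
        exact Nat.floor_le (by positivity)
      have hfail := (toOuterMeasure_run_not_progress_le (adv := adv) (X := X) hk hkn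
        (show 0 < 1 - β by linarith) (by linarith) (twenty_le_log hlarge) hb hpick hR1 hRN
        (by exact_mod_cast hR) t).trans (sum_stepFailure_le k n R t)
      refine of_compl _ (by positivity) ((failure_le hk hkn hRN).trans ?_) _ hfail
        fun h hh hP => Progress.mem_success hk hn hβ hβ1 (by norm_num) hX hRd (hsupp h hh).2 ht hP
      gcongr
      norm_num
  · exact of_compl 0 le_rfl (by positivity) Set.univ (by simp) fun h hh _ =>
      mem_success_of_not_exists hk hn hβ hβ1 (by norm_num) hX (hsupp h hh).2 ht

end CCA

theorem mainTheorem3 :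
    ∃ C : ℝ, 0 < C ∧
      ∀ (n k : ℕ) (β : ℝ), 2 ≤ k → k ≤ n → 0 ≤ β → β < 1 →
      ∀ pick : Fin k → ℕ → ℕ → Finset (Fin n) → Fin n,
        (∀ i r s K, K.Nonempty → pick i r s K ∈ K) →
      ∀ (X : Fin n → Bool)
        (adv : CCA.Adversary (CCA.randomizedDisjunction k n (1 - β) pick)) (t : ℕ),
        C * (Real.logb 2 k * Real.logb 2 (2 / CCA.modifiedDensity X)) ≤ (t : ℝ) →
        ENNReal.ofReal (1 - C / n) ≤
          (CCA.run (CCA.randomizedDisjunction k n (1 - β) pick) X adv ⌊β * k⌋₊ t).toOuterMeasure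
            {h | CCA.SolvesDisjunction X h ∧
              (∀ i ∉ h.corrupted, (h.queries i : ℝ) ≤
                C * (Real.logb 2 n / ((1 - β) * k * CCA.modifiedDensity X) +
                  Real.logb 2 k * Real.logb 2 n * Real.logb 2 (2 / CCA.modifiedDensity X) /
                    (1 - β))) ∧
              (h.messages : ℝ) ≤
                C * ((k : ℝ) ^ 2 * Real.logb 2 k *
                  Real.logb 2 (2 / CCA.modifiedDensity X))} :=
  ⟨10 ^ 9, by norm_num, fun _ _ _ hk hkn hβ hβ1 _ hpick X adv t ht =>
    CCA.le_toOuterMeasure_success hk hkn hβ hβ1 hpick X adv t ht⟩
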